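/- Let $G$ be a group generated as a monoid by a finite set $S\subseteq G$, and let each $s\in S$ carry a positive integer weight $\omega(s)$. The weight $\omega(\sigma)$ of a word $\sigma\in S^*$ is the sum of the weights of its letters, and $\sigma$ is a geodesic if no word representing the same element of $G$ has smaller weight. Let $\gamma_S(n)$ be the number of geodesic words $\sigma\in S^*$ with $\omega(\sigma)\le n$, and let $f_S(z)=\sum_{n\ge 0}\gamma_S(n)z^n\in\mathbb{C}[[z]]$ be the geodesic growth series. The geodesic growth is polynomial if there are positive integers $\beta,d$ with $\gamma_S(n)\le \beta n^d$ for all $n>0$; it is exponential if there is a real $\alpha>1$ with $\gamma_S(n)\ge\alpha^n$ for all sufficiently large $n$. A power series $f\in\mathbb{C}[[z]]$ is holonomic if its formal derivatives $f,f',f'',\dots$ span a finite-dimensional $\mathbb{C}(z)$-subspace of $\mathbb{C}((z))$. Suppose that $f_S(z)$ is holonomic. Then either $G$ has exponential geodesic growth with respect to $S$, or $f_S(z)$ is rational and $G$ has polynomial geodesic growth with respect to $S$. (The geodesic growth is never both exponential and polynomial.) -/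

import Mathlib

noncomputable section

open Filter
open scoped PowerSeries LaurentSeries RatFunc

namespace GeodesicGrowth

variable {G : Type*} [Group G] {S : Finset G}

/-- The group element represented by a word in the letters of `S`. -/
def eval (σ : List S) : G := (σ.map fun s => (s : G)).prod

/-- The weight of a word: the sum of the weights of its letters. -/
def weight (ω : S → ℕ+) (σ : List S) : ℕ := (σ.map fun s => (ω s : ℕ)).sum

/-- The weighted length of `g`: the least weight of a word that represents `g`
(such a word exists for every `g` when `S` generates `G` as a monoid). -/
def weightedLength (ω : S → ℕ+) (g : G) : ℕ :=
  sInf {n : ℕ | ∃ σ : List S, eval σ = g ∧ weight ω σ = n}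

/-- A word is a geodesic if it has minimal weight among the words representing the same element. -/
def IsGeodesic (ω : S → ℕ+) (σ : List S) : Prop :=
  weight ω σ = weightedLength ω (eval σ)

/-- There are finitely many words of bounded weight, so that the count below is a true count. -/
theorem finite_weight_le {H : Type*} {T : Finset H} (ω : T → ℕ+) (n : ℕ) :
    {σ : List T | weight ω σ ≤ n}.Finite := by
  refine (List.finite_length_le T n).subset fun σ hσ => ?_
  change σ.length ≤ n
  have h : ∀ τ : List T, τ.length ≤ weight ω τ := fun τ => by
    induction τ with
    | nil => simp
    | cons a l ih =>
      have := (ω a).pos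
      simp only [weight, List.map_cons, List.sum_cons, List.length_cons] at ih ⊢
      omega
  exact (h σ).trans hσ

/-- The geodesic growth function: the number of geodesic words of weight at most `n`. -/
def geodesicGrowth (ω : S → ℕ+) (n : ℕ) : ℕ :=
  {σ : List S | weight ω σ ≤ n ∧ IsGeodesic ω σ}.ncard

/-- The geodesic growth series `∑ γ(n) zⁿ`, as a formal power series over `ℂ`. -/
def geodesicGrowthSeries (ω : S → ℕ+) : ℂ⟦X⟧ :=
  PowerSeries.mk fun n => (geodesicGrowth ω n : ℂ)

/-- Polynomial geodesic growth: `γ(n) ≤ β n ^ d` for every `n > 0`. -/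
def HasPolynomialGeodesicGrowth (ω : S → ℕ+) : Prop :=
  ∃ β d : ℕ, 0 < β ∧ 0 < d ∧ ∀ n : ℕ, 0 < n → geodesicGrowth ω n ≤ β * n ^ d

/-- Exponential geodesic growth: for some `α > 1`, `γ(n) ≥ α ^ n` for all sufficiently large `n`.
The bound cannot be asked for at every `n`: if all weights are at least `2`, then `γ(1) = 1`. -/
def HasExponentialGeodesicGrowth (ω : S → ℕ+) : Prop :=
  ∃ α : ℝ, 1 < α ∧ ∀ᶠ n : ℕ in atTop, α ^ n ≤ (geodesicGrowth ω n : ℝ)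

end GeodesicGrowth

/-- A power series in one variable is holonomic if its formal derivatives span a
finite-dimensional vector space over `ℂ(z)` inside `ℂ((z))`. -/
def IsHolonomic (f : ℂ⟦X⟧) : Prop :=
  FiniteDimensional (RatFunc ℂ)
    (Submodule.span (RatFunc ℂ)
      (Set.range fun k : ℕ => HahnSeries.ofPowerSeries ℤ ℂ ((PowerSeries.derivative ℂ)^[k] f)))

/-- A power series is rational if, inside `ℂ((z))`, it is the expansion of a rational function. -/
def IsRationalSeries (f : ℂ⟦X⟧) : Prop :=
  ∃ r : RatFunc ℂ, algebraMap (RatFunc ℂ) ℂ⸨X⸩ r = HahnSeries.ofPowerSeries ℤ ℂ f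

end

noncomputable section

open Filter
open scoped PowerSeries LaurentSeries RatFunc

/-! ### Geodesic words and submultiplicativity of their growth. -/

namespace GeodesicGrowth

variable {G : Type*} [Group G] {S : Finset G}

/-! Factors of geodesics are geodesic, so the growth function γ is submultiplicative up to a shift
by the largest letter weight. Hence a single large `n` with γ(n) below `√x ^ n` already forces γ(n)
= O(x ^ n) for all `n`. If growth is not exponential, this holds for every `x > 1`, and the growth
series converges on the open unit disc (`exists_geodesicGrowth_le_pow`).

A holonomic series satisfies a linear differential equation with polynomial coefficients. Its sum
therefore continues analytically across every point of the unit circle that is not a root of the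
leading coefficient, that is, across all but finitely many (`IsHolonomic.exists_extendsAt`).

The coefficients of the series F are integers, and this forces rationality, in the spirit of Pólya
and Carlson (`exists_polynomial_mul_intSeries_eq`). Siegel's lemma gives a Padé pair Q, P of degree
less than 2e with small coefficients such that QF - P vanishes to order N ≥ 3e. If QF ≠ P, the
lowest coefficient of the remainder is a nonzero integer, so of modulus at least 1. Pulling the
remainder back along a map u ↦ u ψ(u) of the closed disc into the domain of the continuation, with
|u ψ(u)| ≤ exp δ and |ψ(0)| ≥ exp(3δ/4), and applying the maximum principle after division by u ^ N,
bounds exp(3δ/4 · 3e) by roughly exp(δ · 2e). Since 9/4 > 2, this fails for large e.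

Finally, a rational series converging on the open disc has no poles there, so its coefficients grow
at most polynomially (`DiscConvergent.polynomiallyBounded`). -/

theorem eval_append (σ τ : List S) : eval (σ ++ τ) = eval σ * eval τ := by
  simp [eval]

theorem weight_append {H : Type*} {T : Finset H} (ω : T → ℕ+) (σ τ : List T) :
    weight ω (σ ++ τ) = weight ω σ + weight ω τ := by
  simp [weight]

theorem weightedLength_eval_le (ω : S → ℕ+) (σ : List S) :
    weightedLength ω (eval σ) ≤ weight ω σ :=
  Nat.sInf_le ⟨σ, rfl, rfl⟩

theorem exists_weight_eq_weightedLength (ω : S → ℕ+) (σ : List S) :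
    ∃ τ : List S, eval τ = eval σ ∧ weight ω τ = weightedLength ω (eval σ) :=
  Nat.sInf_mem (s := {n : ℕ | ∃ τ : List S, eval τ = eval σ ∧ weight ω τ = n}) ⟨_, σ, rfl, rfl⟩

/-- Replacing the prefix by a lighter word for the same element would make the whole word lighter.
-/
theorem IsGeodesic.left {ω : S → ℕ+} {σ τ : List S} (h : IsGeodesic ω (σ ++ τ)) :
    IsGeodesic ω σ := by
  obtain ⟨σ', h1, h2⟩ := exists_weight_eq_weightedLength ω σ
  have h3 := weightedLength_eval_le ω (σ' ++ τ)
  have h4 := weightedLength_eval_le ω σ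
  rw [eval_append, h1, ← eval_append, ← h, weight_append, weight_append] at h3
  unfold IsGeodesic
  omega

theorem IsGeodesic.right {ω : S → ℕ+} {σ τ : List S} (h : IsGeodesic ω (σ ++ τ)) :
    IsGeodesic ω τ := by
  obtain ⟨τ', h1, h2⟩ := exists_weight_eq_weightedLength ω τ
  have h3 := weightedLength_eval_le ω (σ ++ τ')
  have h4 := weightedLength_eval_le ω τ
  rw [eval_append, h1, ← eval_append, ← h, weight_append, weight_append] at h3
  unfold IsGeodesic
  omega

theorem isGeodesic_nil (ω : S → ℕ+) : IsGeodesic ω ([] : List S) := by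
  have := weightedLength_eval_le ω ([] : List S)
  simp only [weight, List.map_nil, List.sum_nil, nonpos_iff_eq_zero] at this
  simp [IsGeodesic, this, weight]

/-- The largest weight of a letter. -/
def maxWeight {H : Type*} {T : Finset H} (ω : T → ℕ+) : ℕ := Finset.univ.sup fun s => (ω s : ℕ)

/-- A word can be cut so that its tail is short and its head overshoots by at most one letter. -/
theorem exists_append_of_weight_le {H : Type*} {T : Finset H} (ω : T → ℕ+) (k : ℕ) (σ : List T)
    (s : ℕ)
    (h : weight ω σ ≤ s + k) :
    ∃ τ ρ : List T, σ = τ ++ ρ ∧ weight ω τ ≤ s + maxWeight ω ∧ weight ω ρ ≤ k := by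
  induction σ generalizing s with
  | nil => exact ⟨[], [], rfl, by simp [weight], by simp [weight]⟩
  | cons x l ih =>
    have hx : (ω x : ℕ) ≤ maxWeight ω :=
      Finset.le_sup (f := fun s => (ω s : ℕ)) (Finset.mem_univ x)
    have hc : ∀ t : List T, weight ω (x :: t) = ω x + weight ω t := fun t => by simp [weight]
    rw [hc] at h
    rcases le_or_gt (ω x : ℕ) s with hs | hs
    · obtain ⟨τ, ρ, h1, h2, h3⟩ := ih (s - ω x) (by omega)
      refine ⟨x :: τ, ρ, by simp [h1], ?_, h3⟩
      rw [hc]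
      omega
    · refine ⟨[x], l, rfl, ?_, by omega⟩
      rw [hc]
      simp only [weight, List.map_nil, List.sum_nil]
      omega

theorem finite_geodesic (ω : S → ℕ+) (n : ℕ) :
    {σ : List S | weight ω σ ≤ n ∧ IsGeodesic ω σ}.Finite :=
  (finite_weight_le ω n).subset fun _ h => h.1

theorem geodesicGrowth_mono (ω : S → ℕ+) : Monotone (geodesicGrowth ω) := fun _ n h =>
  Set.ncard_le_ncard (fun _ hσ => ⟨hσ.1.trans h, hσ.2⟩) (finite_geodesic ω n)

theorem one_le_geodesicGrowth (ω : S → ℕ+) (n : ℕ) : 1 ≤ geodesicGrowth ω n :=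
  (Set.ncard_pos (finite_geodesic ω n)).2 ⟨[], by simp [weight], isGeodesic_nil ω⟩

/-- Cutting a geodesic near weight `s` leaves two geodesics whose concatenation recovers it. The cut
may fall inside a letter, hence the extra `maxWeight ω`. -/
theorem geodesicGrowth_add_le (ω : S → ℕ+) (s k : ℕ) :
    geodesicGrowth ω (s + k) ≤ geodesicGrowth ω (s + maxWeight ω) * geodesicGrowth ω k := by
  unfold geodesicGrowth
  rw [← Set.ncard_prod]
  refine (Set.ncard_le_ncard (t := (fun p : List S × List S => p.1 ++ p.2) '' _) ?_
    (((finite_geodesic ω (s + maxWeight ω)).prod (finite_geodesic ω k)).image _)).trans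
    (Set.ncard_image_le ((finite_geodesic ω (s + maxWeight ω)).prod (finite_geodesic ω k)))
  rintro σ ⟨h1, h2⟩
  obtain ⟨τ, ρ, rfl, h3, h4⟩ := exists_append_of_weight_le ω k σ s h1
  exact ⟨(τ, ρ), ⟨⟨h3, h2.left⟩, ⟨h4, h2.right⟩⟩, rfl⟩

/-- One value of γ below `√x ^ n` suffices: it yields an `s` with γ(s + k) ≤ `x ^ s` γ(k) for all
`k`, and this inequality is iterated in blocks of length `s`. -/
theorem exists_geodesicGrowth_le_pow {ω : S → ℕ+} (h : ¬ HasExponentialGeodesicGrowth ω)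
    {x : ℝ} (hx : 1 < x) : ∃ C : ℝ, 0 < C ∧ ∀ n, (geodesicGrowth ω n : ℝ) ≤ C * x ^ n := by
  have hx1 : 1 < √x := by rw [Real.lt_sqrt] <;> simp [hx]
  have h1 : ∃ᶠ n : ℕ in atTop, ¬ (√x ^ n ≤ (geodesicGrowth ω n : ℝ)) := by
    intro h2
    exact h ⟨√x, hx1, by simpa using h2⟩
  -- The threshold makes `s > maxWeight ω`. Hence `s + maxWeight ω ≤ 2 * s`, which turns `√x` into
  -- `x`, and `s > 0`, so the induction below descends.
  obtain ⟨n₀, hn, hγ⟩ := (frequently_atTop.1 h1) (2 * maxWeight ω + 1)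
  obtain ⟨s, rfl⟩ : ∃ s, n₀ = s + maxWeight ω := ⟨n₀ - maxWeight ω, by omega⟩
  have hb : (geodesicGrowth ω (s + maxWeight ω) : ℝ) ≤ x ^ s := by
    calc (geodesicGrowth ω (s + maxWeight ω) : ℝ) ≤ √x ^ (s + maxWeight ω) := (not_le.1 hγ).le
      _ ≤ √x ^ (2 * s) := pow_le_pow_right₀ hx1.le (by omega)
      _ = x ^ s := by rw [pow_mul, Real.sq_sqrt (by linarith)]
  refine ⟨geodesicGrowth ω s, by exact_mod_cast one_le_geodesicGrowth ω s, fun n => ?_⟩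
  induction n using Nat.strong_induction_on with
  | _ n ih =>
    rcases le_or_gt n s with hns | hns
    · have h2 : (geodesicGrowth ω n : ℝ) ≤ geodesicGrowth ω s := by
        exact_mod_cast geodesicGrowth_mono ω hns
      exact h2.trans (le_mul_of_one_le_right (by positivity) (one_le_pow₀ hx.le))
    · obtain ⟨k, rfl⟩ : ∃ k, n = s + k := ⟨n - s, by omega⟩
      have h2 : (geodesicGrowth ω (s + k) : ℝ) ≤
          geodesicGrowth ω (s + maxWeight ω) * geodesicGrowth ω k := by
        exact_mod_cast geodesicGrowth_add_le ω s k
      calc _ ≤ _ := h2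
        _ ≤ x ^ s * (geodesicGrowth ω s * x ^ k) := by
            gcongr
            exact ih k (by omega)
        _ = _ := by ring

theorem not_exponential_and_polynomial (ω : S → ℕ+) :
    ¬ (HasExponentialGeodesicGrowth ω ∧ HasPolynomialGeodesicGrowth ω) := by
  rintro ⟨⟨α, hα, h1⟩, β, d, hβ, -, h2⟩
  have h3 := tendsto_pow_const_div_const_pow_of_one_lt d hα
  have hβ' : (0 : ℝ) < β := by exact_mod_cast hβ
  have h4 := h3.eventually (gt_mem_nhds (show (0 : ℝ) < 1 / β by positivity))
  obtain ⟨n, h5, h6, h7⟩ := (h1.and (h4.and (eventually_gt_atTop 0))).exists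
  have h8 : (geodesicGrowth ω n : ℝ) ≤ β * n ^ d := by exact_mod_cast h2 n h7
  have h9 : 0 < α ^ n := by positivity
  rw [div_lt_div_iff₀ h9 hβ'] at h6
  linarith

end GeodesicGrowth

/-! ### Power series convergent on the unit disc and their sums. -/

/-- The power series converges at every point of the open unit disc. -/
def DiscConvergent (F : ℂ⟦X⟧) : Prop :=
  ∀ z : ℂ, ‖z‖ < 1 → Summable fun n => PowerSeries.coeff n F * z ^ n

/-- The sum of a power series, as a function of a complex variable. -/
def discSum (F : ℂ⟦X⟧) (z : ℂ) : ℂ := ∑' n, PowerSeries.coeff n F * z ^ n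

namespace DiscConvergent

open PowerSeries Metric

variable {F K : ℂ⟦X⟧}

theorem of_norm_coeff_le
    (h : ∀ x : ℝ, 1 < x → ∃ C : ℝ, ∀ n, ‖coeff n F‖ ≤ C * x ^ n) : DiscConvergent F := by
  intro z hz
  obtain ⟨y, hy, hy1⟩ := exists_between hz
  have hy0 : 0 < y := (norm_nonneg z).trans_lt hy
  obtain ⟨C, hC⟩ := h y⁻¹ ((one_lt_inv₀ hy0).2 hy1)
  have h1 : Summable fun n : ℕ => C * (y⁻¹ * ‖z‖) ^ n := by
    refine (summable_geometric_of_lt_one (by positivity) ?_).mul_left C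
    rwa [inv_mul_lt_iff₀ hy0, mul_one]
  refine Summable.of_norm_bounded h1 fun n => ?_
  rw [norm_mul, norm_pow, mul_pow, ← mul_assoc]
  gcongr
  exact hC n

theorem of_polynomial (p : Polynomial ℂ) : DiscConvergent (p : ℂ⟦X⟧) := fun z _ =>
  summable_of_ne_finset_zero (s := p.support) fun n hn => by
    simp [Polynomial.notMem_support_iff.1 hn]

theorem add (hF : DiscConvergent F) (hK : DiscConvergent K) : DiscConvergent (F + K) :=
  fun z hz => ((hF z hz).add (hK z hz)).congr fun n => by simp [add_mul]

theorem sub (hF : DiscConvergent F) (hK : DiscConvergent K) : DiscConvergent (F - K) :=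
  fun z hz => ((hF z hz).sub (hK z hz)).congr fun n => by simp [sub_mul]

theorem coeff_mul_mul_pow (z : ℂ) (n : ℕ) : coeff n (F * K) * z ^ n =
    ∑ kl ∈ Finset.HasAntidiagonal.antidiagonal n, coeff kl.1 F * z ^ kl.1 * (coeff kl.2 K * z ^ kl.2) := by
  rw [coeff_mul, Finset.sum_mul]
  refine Finset.sum_congr rfl fun kl hkl => ?_
  rw [← Finset.HasAntidiagonal.mem_antidiagonal.1 hkl, pow_add]
  ring

theorem mul (hF : DiscConvergent F) (hK : DiscConvergent K) : DiscConvergent (F * K) := by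
  intro z hz
  simp_rw [coeff_mul_mul_pow]
  exact (summable_norm_sum_mul_antidiagonal_of_summable_norm (hF z hz).norm (hK z hz).norm).of_norm

theorem of_X_pow_mul {N : ℕ} (h : DiscConvergent (X ^ N * F)) : DiscConvergent F := by
  intro z hz
  rcases eq_or_ne z 0 with rfl | h0
  · exact summable_of_ne_finset_zero (s := {0}) fun n hn => by simp_all
  · have h1 := ((summable_nat_add_iff N).2 (h z hz)).mul_left (z ^ N)⁻¹
    refine h1.congr fun n => ?_
    rw [coeff_X_pow_mul, pow_add]
    field_simp

theorem hasFPowerSeriesOnBall (hF : DiscConvergent F) :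
    HasFPowerSeriesOnBall (discSum F)
      (FormalMultilinearSeries.ofScalars ℂ fun n => coeff n F) 0 1 where
  r_le := by
    refine ENNReal.le_of_forall_nnreal_lt fun r hr => ?_
    refine FormalMultilinearSeries.le_radius_of_tendsto (l := 0) _ ?_
    have h1 := (hF (r : ℝ) (by simpa using hr)).norm.tendsto_atTop_zero
    simpa [FormalMultilinearSeries.ofScalars_norm] using h1
  r_pos := one_pos
  hasSum := fun {y} hy => by
    have hy' : ‖y‖ < 1 := by
      rw [← ENNReal.ofReal_one, Metric.eball_ofReal] at hy
      simpa using hy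
    simpa [FormalMultilinearSeries.ofScalars_apply_eq, discSum, mul_comm] using (hF y hy').hasSum

theorem differentiableOn (hF : DiscConvergent F) : DifferentiableOn ℂ (discSum F) (ball 0 1) := by
  have := hF.hasFPowerSeriesOnBall.differentiableOn
  simpa [← Metric.eball_ofReal] using this

theorem discSum_add (hF : DiscConvergent F) (hK : DiscConvergent K) {z : ℂ} (hz : ‖z‖ < 1) :
    discSum (F + K) z = discSum F z + discSum K z := by
  rw [discSum, discSum, discSum, ← (hF z hz).tsum_add (hK z hz)]
  exact tsum_congr fun n => by simp [add_mul]

theorem discSum_sub (hF : DiscConvergent F) (hK : DiscConvergent K) {z : ℂ} (hz : ‖z‖ < 1) :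
    discSum (F - K) z = discSum F z - discSum K z := by
  rw [discSum, discSum, discSum, ← (hF z hz).tsum_sub (hK z hz)]
  exact tsum_congr fun n => by simp [sub_mul]

theorem discSum_mul (hF : DiscConvergent F) (hK : DiscConvergent K) {z : ℂ} (hz : ‖z‖ < 1) :
    discSum (F * K) z = discSum F z * discSum K z := by
  rw [discSum, discSum, discSum,
    tsum_mul_tsum_eq_tsum_sum_antidiagonal_of_summable_norm (hF z hz).norm (hK z hz).norm]
  exact tsum_congr fun n => coeff_mul_mul_pow z n

theorem discSum_polynomial (p : Polynomial ℂ) (z : ℂ) : discSum (p : ℂ⟦X⟧) z = p.eval z := by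
  rw [discSum, tsum_eq_sum (s := p.support), Polynomial.eval_eq_sum, Polynomial.sum]
  · simp
  · intro n hn
    simp [Polynomial.notMem_support_iff.1 hn]

theorem discSum_zero_right (F : ℂ⟦X⟧) : discSum F 0 = coeff 0 F := by
  rw [discSum, tsum_eq_single 0]
  · simp
  · intro n hn
    simp [hn]

theorem iteratedDeriv_zero (hF : DiscConvergent F) (n : ℕ) :
    iteratedDeriv n (discSum F) 0 = n.factorial * coeff n F := by
  have h1 := hF.hasFPowerSeriesOnBall.hasFPowerSeriesAt
  have h2 := h1.analyticAt.hasFPowerSeriesAt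
  have h3 := congrFun (FormalMultilinearSeries.ofScalars_series_injective ℂ ℂ
    (h1.eq_formalMultilinearSeries h2)) n
  have h4 : (n.factorial : ℂ) ≠ 0 := by exact_mod_cast n.factorial_ne_zero
  rw [h3]
  field_simp

theorem hasSum_derivative (hF : DiscConvergent F) {z : ℂ} (hz : ‖z‖ < 1) :
    HasSum (fun n => coeff n (PowerSeries.derivative ℂ F) * z ^ n) (deriv (discSum F) z) := by
  have h1 : DifferentiableOn ℂ (deriv (discSum F)) (ball 0 1) :=
    hF.differentiableOn.deriv isOpen_ball
  have h2 := Complex.hasSum_taylorSeries_on_ball h1 (z := z) (by simpa using hz)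
  refine h2.congr_fun fun n => ?_
  have h4 : (n.factorial : ℂ) ≠ 0 := by exact_mod_cast n.factorial_ne_zero
  rw [← iteratedDeriv_succ', hF.iteratedDeriv_zero, coeff_derivative, Nat.factorial_succ]
  simp only [sub_zero, smul_eq_mul]
  push_cast
  field_simp

theorem derivative (hF : DiscConvergent F) : DiscConvergent (PowerSeries.derivative ℂ F) :=
  fun _ hz => (hF.hasSum_derivative hz).summable

theorem discSum_derivative (hF : DiscConvergent F) {z : ℂ} (hz : ‖z‖ < 1) :
    discSum (PowerSeries.derivative ℂ F) z = deriv (discSum F) z :=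
  (hF.hasSum_derivative hz).tsum_eq

theorem iterate_derivative (hF : DiscConvergent F) (k : ℕ) :
    DiscConvergent ((PowerSeries.derivative ℂ)^[k] F) := by
  induction k with
  | zero => exact hF
  | succ k ih =>
    rw [Function.iterate_succ_apply']
    exact ih.derivative

theorem discSum_iterate_derivative (hF : DiscConvergent F) (k : ℕ) {z : ℂ} (hz : ‖z‖ < 1) :
    discSum ((PowerSeries.derivative ℂ)^[k] F) z = iteratedDeriv k (discSum F) z := by
  induction k generalizing z with
  | zero => simp
  | succ k ih =>
    rw [Function.iterate_succ_apply', (hF.iterate_derivative k).discSum_derivative hz,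
      iteratedDeriv_succ]
    refine Filter.EventuallyEq.deriv_eq ?_
    filter_upwards [isOpen_ball.mem_nhds (show z ∈ ball (0 : ℂ) 1 by simpa using hz)] with w hw
    exact ih (by simpa using hw)

end DiscConvergent

/-! ### Analytic continuation of solutions of linear differential equations. -/

section AnalyticContinuation

open Metric
open scoped Nat Topology

/-- A convolution inequality with geometric kernel `M * ρ⁻¹ ^ i` forces `u n / n!` to grow at most
like `σ⁻¹ ^ n` for every `σ < ρ`. -/
theorem exists_le_factorial_mul_pow {u : ℕ → ℝ} (hu : ∀ n, 0 ≤ u n) {M ρ σ : ℝ}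
    (hσ : 0 < σ) (hσρ : σ < ρ)
    (h : ∀ n, u (n + 1) ≤ u n + ∑ i ∈ Finset.range (n + 1),
      (n.choose i : ℝ) * (i ! * M / ρ ^ i) * u (n - i)) :
    ∃ C : ℝ, ∀ n, u n / n ! * σ ^ n ≤ C := by
  have hρ : 0 < ρ := hσ.trans hσρ
  set v : ℕ → ℝ := fun n => u n / n ! * ρ ^ n with hv
  have hv0 : ∀ n, 0 ≤ v n := fun n => by have := hu n; positivity
  set s : ℕ → ℝ := fun n => ∑ i ∈ Finset.range (n + 1), v i with hs
  have hs0 : ∀ n, 0 ≤ s n := fun n => Finset.sum_nonneg fun i _ => hv0 i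
  have hvs : ∀ n, v n ≤ s n := fun n =>
    Finset.single_le_sum (fun i _ => hv0 i) (Finset.self_mem_range_succ n)
  -- Multiplied by `ρ ^ (n + 1) / n !`, the binomial convolution becomes the plain partial sum `s
  -- n`.
  have hstep : ∀ n, (n + 1) * v (n + 1) ≤ ρ * (M + 1) * s n := by
    intro n
    have hf : (0 : ℝ) < n ! := by positivity
    have e1 : (n + 1) * v (n + 1) = u (n + 1) * (ρ ^ (n + 1) / n !) := by
      simp only [hv, Nat.factorial_succ]
      push_cast
      field_simp
    have e2 : (∑ i ∈ Finset.range (n + 1), (n.choose i : ℝ) * (i ! * M / ρ ^ i) * u (n - i)) *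
        (ρ ^ (n + 1) / n !) = ρ * M * s n := by
      change _ = ρ * M * ∑ i ∈ Finset.range (n + 1), v i
      rw [← Finset.sum_range_reflect v, Finset.sum_mul, Finset.mul_sum]
      refine Finset.sum_congr rfl fun i hi => ?_
      have hi' : i ≤ n := by simpa [Nat.lt_succ_iff] using hi
      rw [show n + 1 - 1 - i = n - i by omega]
      simp only [hv]
      have h1 : (n.choose i : ℝ) * i ! * (n - i)! = n ! := by
        exact_mod_cast Nat.choose_mul_factorial_mul_factorial hi'
      have h2 : ρ ^ (n + 1) = ρ * (ρ ^ i * ρ ^ (n - i)) := by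
        rw [← pow_add, Nat.add_sub_cancel' hi']
        ring
      rw [← h1, h2]
      have : (n.choose i : ℝ) ≠ 0 := by exact_mod_cast (Nat.choose_pos hi').ne'
      field_simp
    have e3 : u n * (ρ ^ (n + 1) / n !) = ρ * v n := by
      simp only [hv]
      ring
    rw [e1]
    calc u (n + 1) * (ρ ^ (n + 1) / n !) ≤ _ * (ρ ^ (n + 1) / n !) :=
          mul_le_mul_of_nonneg_right (h n) (by positivity)
      _ = ρ * v n + ρ * M * s n := by rw [add_mul, e2, e3]
      _ ≤ ρ * s n + ρ * M * s n := by gcongr; exact hvs n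
      _ = _ := by ring
  -- From index `N` on, `s (n + 1) / s n` is at most `1 + ρ * (M + 1) / (n + 1) ≤ ρ / σ`.
  obtain ⟨N, hN⟩ := exists_nat_ge (ρ * (M + 1) / (ρ / σ - 1))
  have hτ : 0 < ρ / σ - 1 := sub_pos.2 ((one_lt_div hσ).2 hσρ)
  have hmono : Monotone s := monotone_nat_of_le_succ fun n => by
    simp only [hs]
    rw [Finset.sum_range_succ _ (n + 1)]
    linarith [hv0 (n + 1)]
  have hgrow : ∀ n, s n ≤ s N * (ρ / σ) ^ n := by
    intro n
    induction n with
    | zero => simpa using hmono (Nat.zero_le N)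
    | succ n ih =>
      have h1 : 1 ≤ ρ / σ := by linarith
      rcases le_or_gt (n + 1) N with hn | hn
      · exact (hmono hn).trans (le_mul_of_one_le_right (hs0 N) (one_le_pow₀ h1))
      · have h2 : (N : ℝ) ≤ n + 1 := by exact_mod_cast hn.le
        have h3 : ρ * (M + 1) ≤ (n + 1) * (ρ / σ - 1) := by
          rw [div_le_iff₀ hτ] at hN
          exact hN.trans (by gcongr)
        have h4 : v (n + 1) ≤ (ρ / σ - 1) * s n := by
          have h5 := (hstep n).trans (mul_le_mul_of_nonneg_right h3 (hs0 n))
          rw [mul_assoc] at h5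
          exact le_of_mul_le_mul_left h5 (by positivity)
        have h5 : s (n + 1) = s n + v (n + 1) := Finset.sum_range_succ _ _
        calc s (n + 1) ≤ ρ / σ * s n := by linarith
          _ ≤ ρ / σ * (s N * (ρ / σ) ^ n) := by gcongr
          _ = _ := by ring
  refine ⟨s N, fun n => ?_⟩
  have h1 := (hvs n).trans (hgrow n)
  have h2 : u n / n ! * σ ^ n = v n * (σ / ρ) ^ n := by
    simp only [hv]
    rw [mul_assoc, ← mul_pow]
    congr 2
    field_simp
  rw [h2]
  calc v n * (σ / ρ) ^ n ≤ s N * (ρ / σ) ^ n * (σ / ρ) ^ n := by gcongr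
    _ = s N := by
      rw [mul_assoc, ← mul_pow]
      have : ρ / σ * (σ / ρ) = 1 := by field_simp
      rw [this, one_pow, mul_one]

theorem iteratedDeriv_iteratedDeriv (f : ℂ → ℂ) (n m : ℕ) :
    iteratedDeriv n (iteratedDeriv m f) = iteratedDeriv (n + m) f := by
  simp only [iteratedDeriv_eq_iterate, Function.iterate_add_apply]

/-- Taylor coefficients of a solution of a linear differential equation whose coefficients are
analytic on a ball of radius `ρ`. -/
theorem exists_norm_iteratedDeriv_le {f : ℂ → ℂ} {z₀ : ℂ} (hf : AnalyticAt ℂ f z₀) {r : ℕ}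
    (hr : 0 < r) {b : ℕ → ℂ → ℂ} {ρ σ : ℝ} (hσ : 0 < σ) (hσρ : σ < ρ) {U : Set ℂ} (hU : IsOpen U)
    (hUρ : closedBall z₀ ρ ⊆ U) (hb : ∀ j, DifferentiableOn ℂ (b j) U)
    (hfb : iteratedDeriv r f =ᶠ[𝓝 z₀] fun z => ∑ j ∈ Finset.range r, b j z * iteratedDeriv j f z) :
    ∃ C : ℝ, ∀ n, ‖iteratedDeriv n f z₀‖ / n ! * σ ^ n ≤ C := by
  have hρ : 0 < ρ := hσ.trans hσρ
  have hz₀ : U ∈ 𝓝 z₀ := hU.mem_nhds (hUρ (mem_closedBall_self hρ.le))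
  have hbound : ∀ j, ∃ M : ℝ, ∀ z ∈ closedBall z₀ ρ, ‖b j z‖ ≤ M := fun j =>
    (isCompact_closedBall z₀ ρ).exists_bound_of_continuousOn ((hb j).continuousOn.mono hUρ)
  choose B hB using hbound
  have hB0 : ∀ j, 0 ≤ B j := fun j =>
    (norm_nonneg _).trans (hB j z₀ (mem_closedBall_self hρ.le))
  set M : ℝ := ∑ j ∈ Finset.range r, B j
  have hder : ∀ j ∈ Finset.range r, ∀ i, ‖iteratedDeriv i (b j) z₀‖ ≤ i ! * M / ρ ^ i := by
    intro j hj i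
    refine Complex.norm_iteratedDeriv_le_of_forall_mem_sphere_norm_le i hρ ?_ fun z hz =>
      (hB j z (sphere_subset_closedBall hz)).trans
        (Finset.single_le_sum (f := B) (fun i _ => hB0 i) hj)
    refine ((hb j).mono ?_).diffContOnCl
    rwa [closure_ball z₀ hρ.ne']
  set d : ℕ → ℝ := fun n => ‖iteratedDeriv n f z₀‖ with hd
  have hrec : ∀ n, d (n + r) ≤ ∑ i ∈ Finset.range (n + 1),
      (n.choose i : ℝ) * (i ! * M / ρ ^ i) * ∑ j ∈ Finset.range r, d (n - i + j) := by
    intro n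
    have hba : ∀ j, ContDiffAt ℂ n (b j) z₀ := fun j =>
      ((hb j).analyticAt hz₀).contDiffAt
    have hfa : ∀ j, ContDiffAt ℂ n (iteratedDeriv j f) z₀ := fun j =>
      (iteratedDeriv_eq_iterate (f := f) (n := j) ▸ hf.iterated_deriv j).contDiffAt
    have e1 : iteratedDeriv (n + r) f z₀ = ∑ j ∈ Finset.range r, ∑ i ∈ Finset.range (n + 1),
        n.choose i * iteratedDeriv i (b j) z₀ * iteratedDeriv (n - i + j) f z₀ := by
      rw [← iteratedDeriv_iteratedDeriv, hfb.iteratedDeriv_eq,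
        iteratedDeriv_fun_sum fun j _ => (hba j).mul (hfa j)]
      refine Finset.sum_congr rfl fun j _ => ?_
      rw [iteratedDeriv_fun_mul (hba j) (hfa j)]
      simp only [iteratedDeriv_iteratedDeriv]
    simp only [hd]
    rw [e1, Finset.sum_comm]
    refine (norm_sum_le _ _).trans (Finset.sum_le_sum fun i _ => ?_)
    rw [Finset.mul_sum]
    refine (norm_sum_le _ _).trans (Finset.sum_le_sum fun j hj => ?_)
    rw [norm_mul, norm_mul, Complex.norm_natCast]
    gcongr
    exact hder j hj i
  -- Summing `r` consecutive derivatives turns the recurrence of order `r` into one of first order: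
  -- passing from `n` to `n + 1` adds `d (n + r)` and drops `d n`.
  obtain ⟨C, hC⟩ := exists_le_factorial_mul_pow (u := fun n => ∑ j ∈ Finset.range r, d (n + j))
    (fun n => Finset.sum_nonneg fun _ _ => norm_nonneg _) hσ hσρ fun n => by
      have h1 : ∑ j ∈ Finset.range r, d (n + 1 + j) + d n =
          ∑ j ∈ Finset.range r, d (n + j) + d (n + r) := by
        rw [← Finset.sum_range_succ (fun j => d (n + j)),
          Finset.sum_range_succ' (fun j => d (n + j))]
        simp [add_assoc, add_comm 1]
      have h2 : 0 ≤ d n := norm_nonneg _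
      linarith [hrec n]
  refine ⟨C, fun n => le_trans ?_ (hC n)⟩
  have : d n ≤ ∑ j ∈ Finset.range r, d (n + j) :=
    Finset.single_le_sum (f := fun j => d (n + j)) (fun _ _ => norm_nonneg _)
      (Finset.mem_range.2 hr)
  gcongr

/-- A function on the unit disc extends analytically to a neighbourhood of `ζ`. -/
def ExtendsAt (f : ℂ → ℂ) (ζ : ℂ) : Prop :=
  ∃ ε > 0, ∃ g : ℂ → ℂ, DifferentiableOn ℂ g (ball ζ ε) ∧ ∀ z ∈ ball ζ ε ∩ ball 0 1, g z = f z

/-- Solutions of a linear differential equation with polynomial coefficients extend across every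
point of the unit circle where the leading coefficient does not vanish. -/
theorem extendsAt_of_linear_ode {f : ℂ → ℂ} (hf : DifferentiableOn ℂ f (ball 0 1)) {r : ℕ}
    (hr : 0 < r) (p : ℕ → Polynomial ℂ)
    (hp : ∀ z ∈ ball (0 : ℂ) 1,
      ∑ j ∈ Finset.range (r + 1), (p j).eval z * iteratedDeriv j f z = 0)
    {ζ : ℂ} (hζ : ‖ζ‖ = 1) (hpζ : (p r).eval ζ ≠ 0) : ExtendsAt f ζ := by
  have hU : IsOpen {z : ℂ | (p r).eval z ≠ 0} := isOpen_ne_fun (p r).continuous continuous_const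
  obtain ⟨δ, hδ, hδU⟩ := Metric.isOpen_iff.1 hU ζ hpζ
  obtain ⟨ρ, hρ, hρ1⟩ : ∃ ρ : ℝ, 0 < ρ ∧ 2 * ρ < min δ 1 :=
    ⟨min δ 1 / 4, by positivity, by have : 0 < min δ 1 := by positivity
                                    linarith⟩
  have hρδ : 2 * ρ < δ := hρ1.trans_le (min_le_left _ _)
  have hρ1' : 2 * ρ < 1 := hρ1.trans_le (min_le_right _ _)
  -- The base point lies inside the disc at distance `ρ / 2` from `ζ`. Its closed ball of radius `ρ`
  -- avoids the zeros of `p r`, while a Taylor series converging on radius `3 * ρ / 4` covers the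
  -- ball of radius `ρ / 4` about `ζ`.
  set z₀ : ℂ := ((1 - ρ / 2 : ℝ) : ℂ) * ζ with hz₀
  have hz₀n : ‖z₀‖ = 1 - ρ / 2 := by
    rw [hz₀, norm_mul, hζ, mul_one, Complex.norm_real, Real.norm_of_nonneg (by linarith)]
  have hz₀d : dist z₀ ζ = ρ / 2 := by
    have : z₀ - ζ = ((-(ρ / 2) : ℝ) : ℂ) * ζ := by rw [hz₀]; push_cast; ring
    rw [dist_eq_norm, this, norm_mul, hζ, mul_one, Complex.norm_real, Real.norm_eq_abs, abs_neg,
      abs_of_nonneg (by linarith)]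
  have hz₀D : z₀ ∈ ball (0 : ℂ) 1 := by rw [mem_ball_zero_iff, hz₀n]; linarith
  have hsub : closedBall z₀ ρ ⊆ {z : ℂ | (p r).eval z ≠ 0} := fun z hz => hδU <| by
    rw [mem_ball]
    linarith [dist_triangle z z₀ ζ, mem_closedBall.1 hz]
  have hfa : AnalyticAt ℂ f z₀ := hf.analyticAt (isOpen_ball.mem_nhds hz₀D)
  set σ : ℝ := 3 * ρ / 4 with hσ
  obtain ⟨C, hC⟩ := exists_norm_iteratedDeriv_le hfa hr
    (b := fun j z => -(p j).eval z / (p r).eval z) (σ := σ) (ρ := ρ) (by positivity) (by linarith)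
    hU hsub (fun j => (p j).differentiable.neg.differentiableOn.div
      (p r).differentiable.differentiableOn fun z hz => hz) (by
      filter_upwards [isOpen_ball.mem_nhds hz₀D,
        hU.mem_nhds (hsub (mem_closedBall_self hρ.le))] with z hz hz'
      have h1 := hp z hz
      rw [Finset.sum_range_succ] at h1
      have h2 : ∑ j ∈ Finset.range r, -(p j).eval z / (p r).eval z * iteratedDeriv j f z =
          -(∑ j ∈ Finset.range r, (p j).eval z * iteratedDeriv j f z) / (p r).eval z := by
        rw [← Finset.sum_neg_distrib, Finset.sum_div]
        exact Finset.sum_congr rfl fun j _ => by ring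
      rw [h2, eq_div_iff hz']
      linear_combination h1)
  set q := FormalMultilinearSeries.ofScalars ℂ fun n => iteratedDeriv n f z₀ / n ! with hq
  have hrad : ENNReal.ofReal σ ≤ q.radius := by
    refine q.le_radius_of_bound C fun n => ?_
    rw [hq, FormalMultilinearSeries.ofScalars_norm, norm_div, Complex.norm_natCast,
      Real.coe_toNNReal _ (by positivity)]
    exact hC n
  have hσ0 : 0 < σ := by positivity
  have hqs := (q.hasFPowerSeriesOnBall ((ENNReal.ofReal_pos.2 hσ0).trans_le hrad)).mono
    (ENNReal.ofReal_pos.2 hσ0) hrad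
  set g : ℂ → ℂ := fun z => q.sum (z - z₀) with hg
  have hgs : HasFPowerSeriesOnBall g q z₀ (ENNReal.ofReal σ) := by
    simpa using hqs.comp_sub z₀
  have hgd : DifferentiableOn ℂ g (ball z₀ σ) := by
    simpa [Metric.eball_ofReal] using hgs.differentiableOn
  have hfg : g =ᶠ[𝓝 z₀] f := by
    have h1 := hfa.hasFPowerSeriesAt
    have h2 : HasFPowerSeriesAt g q z₀ := hgs.hasFPowerSeriesAt
    filter_upwards [h1.eventually_hasSum_sub, h2.eventually_hasSum_sub] with z h3 h4
    exact h4.unique h3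
  have heq : Set.EqOn g f (ball z₀ σ ∩ ball 0 1) := by
    refine AnalyticOnNhd.eqOn_of_preconnected_of_eventuallyEq (z₀ := z₀)
      (fun z hz => hgd.analyticAt (isOpen_ball.mem_nhds hz.1))
      (fun z hz => hf.analyticAt (isOpen_ball.mem_nhds hz.2))
      ((convex_ball _ _).inter (convex_ball _ _)).isPreconnected ⟨mem_ball_self hσ0, hz₀D⟩ hfg
  have hsub2 : ball ζ (ρ / 4) ⊆ ball z₀ σ := fun z hz => by
    rw [mem_ball]
    linarith [dist_triangle z ζ z₀, mem_ball.1 hz, dist_comm ζ z₀]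
  exact ⟨ρ / 4, by positivity, g, hgd.mono hsub2, fun z hz => heq ⟨hsub2 hz.1, hz.2⟩⟩

/-- Local extensions across points of the unit circle glue to one function. -/
theorem exists_extension {f : ℂ → ℂ} (hf : DifferentiableOn ℂ f (ball 0 1)) (A : Set ℂ)
    (hA : ∀ ζ ∈ A, ‖ζ‖ = 1 ∧ ExtendsAt f ζ) :
    ∃ (Ω : Set ℂ) (F : ℂ → ℂ), IsOpen Ω ∧ ball 0 1 ⊆ Ω ∧ A ⊆ Ω ∧ DifferentiableOn ℂ F Ω ∧
      ∀ z ∈ ball 0 1, F z = f z := by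
  classical
  choose! hA1 ε hε g hg hgf using hA
  have hcompat : ∀ ζ ∈ A, ∀ ξ ∈ A, ∀ z, z ∈ ball ζ (ε ζ) → z ∈ ball ξ (ε ξ) → g ζ z = g ξ z := by
    intro ζ hζ ξ hξ z hz hz'
    rcases eq_or_ne ζ ξ with rfl | hne
    · rfl
    have h0 : 0 < ε ζ + ε ξ := add_pos (hε ζ hζ) (hε ξ hξ)
    have hd : dist ζ ξ < ε ζ + ε ξ := by
      linarith [dist_triangle ζ z ξ, mem_ball.1 hz, mem_ball.1 hz', dist_comm z ζ]
    -- The point `w` divides the segment from `ζ` to `ξ` in proportion to the two radii. It lies in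
    -- both balls, and strictly inside the unit disc by strict convexity, so both extensions agree
    -- with `f` near `w`.
    set s : ℝ := ε ξ / (ε ζ + ε ξ) with hs
    set t : ℝ := ε ζ / (ε ζ + ε ξ) with ht
    have hs0 : 0 < s := div_pos (hε ξ hξ) h0
    have ht0 : 0 < t := div_pos (hε ζ hζ) h0
    have hst : s + t = 1 := by rw [hs, ht]; field_simp; ring
    set w : ℂ := s • ζ + t • ξ with hw
    have hwD : w ∈ ball (0 : ℂ) 1 := by
      rw [mem_ball_zero_iff]
      exact norm_combo_lt_of_ne (hA1 ζ hζ).le (hA1 ξ hξ).le hne hs0 ht0 hst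
    have hw1 : w ∈ ball ζ (ε ζ) := by
      have : w - ζ = t • (ξ - ζ) := by
        rw [hw, show s = 1 - t by linarith]
        module
      rw [mem_ball, dist_eq_norm, this, norm_smul, Real.norm_of_nonneg ht0.le, ← dist_eq_norm,
        dist_comm, ht, div_mul_eq_mul_div, div_lt_iff₀ h0]
      exact mul_lt_mul_of_pos_left hd (hε ζ hζ)
    have hw2 : w ∈ ball ξ (ε ξ) := by
      have : w - ξ = s • (ζ - ξ) := by
        rw [hw, show t = 1 - s by linarith]
        module
      rw [mem_ball, dist_eq_norm, this, norm_smul, Real.norm_of_nonneg hs0.le, ← dist_eq_norm,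
        hs, div_mul_eq_mul_div, div_lt_iff₀ h0]
      exact mul_lt_mul_of_pos_left hd (hε ξ hξ)
    refine AnalyticOnNhd.eqOn_of_preconnected_of_eventuallyEq (z₀ := w)
      (U := ball ζ (ε ζ) ∩ ball ξ (ε ξ))
      (fun z hz => (hg ζ hζ).analyticAt (isOpen_ball.mem_nhds hz.1))
      (fun z hz => (hg ξ hξ).analyticAt (isOpen_ball.mem_nhds hz.2))
      ((convex_ball _ _).inter (convex_ball _ _)).isPreconnected ⟨hw1, hw2⟩ ?_ ⟨hz, hz'⟩
    filter_upwards [isOpen_ball.mem_nhds hw1, isOpen_ball.mem_nhds hw2,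
      isOpen_ball.mem_nhds hwD] with y h1 h2 h3
    rw [hgf ζ hζ y ⟨h1, h3⟩, hgf ξ hξ y ⟨h2, h3⟩]
  set F : ℂ → ℂ := fun z => if z ∈ ball (0 : ℂ) 1 then f z else
    if h : ∃ ζ ∈ A, z ∈ ball ζ (ε ζ) then g h.choose z else 0 with hF
  have hFf : ∀ z ∈ ball (0 : ℂ) 1, F z = f z := fun z hz => if_pos hz
  have hFg : ∀ ζ ∈ A, ∀ z ∈ ball ζ (ε ζ), F z = g ζ z := by
    intro ζ hζ z hz
    by_cases hzD : z ∈ ball (0 : ℂ) 1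
    · rw [hFf z hzD, hgf ζ hζ z ⟨hz, hzD⟩]
    · have h : ∃ ζ ∈ A, z ∈ ball ζ (ε ζ) := ⟨ζ, hζ, hz⟩
      simp only [hF, if_neg hzD, dif_pos h]
      exact hcompat _ h.choose_spec.1 ζ hζ z h.choose_spec.2 hz
  refine ⟨ball 0 1 ∪ ⋃ ζ ∈ A, ball ζ (ε ζ), F,
    isOpen_ball.union (isOpen_biUnion fun _ _ => isOpen_ball), Set.subset_union_left,
    fun ζ hζ => Or.inr (Set.mem_biUnion hζ (mem_ball_self (hε ζ hζ))), ?_, hFf⟩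
  rintro z (hz | hz)
  · refine DifferentiableAt.differentiableWithinAt ?_
    exact (hf.differentiableAt (isOpen_ball.mem_nhds hz)).congr_of_eventuallyEq
      (eventually_of_mem (isOpen_ball.mem_nhds hz) hFf)
  · obtain ⟨ζ, hζ, hz⟩ := Set.mem_iUnion₂.1 hz
    refine DifferentiableAt.differentiableWithinAt ?_
    exact ((hg ζ hζ).differentiableAt (isOpen_ball.mem_nhds hz)).congr_of_eventuallyEq
      (eventually_of_mem (isOpen_ball.mem_nhds hz) (hFg ζ hζ))

end AnalyticContinuation

/-! ### Maps of the closed disc into the extended domain. -/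

section Reparametrization

open Metric
open scoped Topology ComplexConjugate

theorem Complex.re_one_add_div_one_sub_nonneg {t : ℂ} (ht : ‖t‖ < 1) :
    0 ≤ ((1 + t) / (1 - t)).re := by
  have h1 : t.re * t.re + t.im * t.im < 1 := by
    rw [← Complex.normSq_apply, ← Complex.sq_norm]
    nlinarith [norm_nonneg t]
  rw [Complex.div_re, ← add_div]
  refine div_nonneg ?_ (Complex.normSq_nonneg _)
  simp only [Complex.add_re, Complex.sub_re, Complex.add_im, Complex.sub_im, Complex.one_re,
    Complex.one_im]
  nlinarith

/-- A function on the closed disc with real part at most `1`, value close to `1` at the origin, and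
negative real part at finitely many given points of the unit circle. -/
theorem exists_re_neg_on_finset (Z : Finset ℂ) (hZ : ∀ ζ ∈ Z, ‖ζ‖ = 1) :
    ∃ g : ℂ → ℂ, (∀ u ∈ closedBall (0 : ℂ) 1, DifferentiableAt ℂ g u) ∧ 3 / 4 ≤ (g 0).re ∧
      (∀ u ∈ closedBall (0 : ℂ) 1, (g u).re ≤ 1) ∧ ∀ ζ ∈ Z, (g ζ).re < 0 := by
  -- Small enough that the kernels below, each equal to 1 at the origin, cost `g 0` at most `1 / 4`
  -- in total.
  set c : ℝ := 1 / (4 * (Z.card + 1)) with hc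
  have hc0 : 0 < c := by positivity
  have hc1 : c ≤ 1 / 4 := by
    rw [hc]
    gcongr
    linarith [(Nat.cast_nonneg Z.card : (0 : ℝ) ≤ _)]
  have ht : ∀ u ∈ closedBall (0 : ℂ) 1, ∀ ζ ∈ Z, ‖((1 - c : ℝ) : ℂ) * u * conj ζ‖ < 1 := by
    intro u hu ζ hζ
    rw [norm_mul, norm_mul, Complex.norm_conj, hZ ζ hζ, mul_one, Complex.norm_real,
      Real.norm_of_nonneg (by linarith)]
    have : ‖u‖ ≤ 1 := by simpa using hu
    nlinarith [norm_nonneg u]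
  have hre : ∀ u ∈ closedBall (0 : ℂ) 1, ∀ ζ ∈ Z,
      0 ≤ ((1 + ((1 - c : ℝ) : ℂ) * u * conj ζ) / (1 - ((1 - c : ℝ) : ℂ) * u * conj ζ)).re :=
    fun u hu ζ hζ => Complex.re_one_add_div_one_sub_nonneg (ht u hu ζ hζ)
  -- Each summand is a Herglotz kernel, with nonnegative real part on the closed disc. Shrinking by
  -- `1 - c` moves its pole off the closed disc; at `u = ζ` it still contributes `c * ((2 - c) / c)
  -- = 2 - c > 1`.
  set g : ℂ → ℂ := fun u => 1 - ∑ ζ ∈ Z,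
    (c : ℂ) * ((1 + ((1 - c : ℝ) : ℂ) * u * conj ζ) / (1 - ((1 - c : ℝ) : ℂ) * u * conj ζ)) with hg
  have hgre : ∀ u, (g u).re = 1 - ∑ ζ ∈ Z,
      c * ((1 + ((1 - c : ℝ) : ℂ) * u * conj ζ) / (1 - ((1 - c : ℝ) : ℂ) * u * conj ζ)).re := by
    intro u
    simp only [hg, Complex.sub_re, Complex.one_re, Complex.re_sum, Complex.re_ofReal_mul]
  refine ⟨g, fun u hu => ?_, ?_, fun u hu => ?_, fun ζ hζ => ?_⟩
  · refine (differentiableAt_const _).sub (DifferentiableAt.fun_sum fun ζ hζ => ?_)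
    refine (differentiableAt_const _).mul (DifferentiableAt.div (by fun_prop) (by fun_prop) ?_)
    intro h0
    have h1 := ht u hu ζ hζ
    rw [← sub_eq_zero.1 h0] at h1
    simp at h1
  · rw [hgre]
    simp only [mul_zero, zero_mul, add_zero, sub_zero, div_one, Complex.one_re, mul_one,
      Finset.sum_const, nsmul_eq_mul]
    have : (Z.card : ℝ) * c ≤ 1 / 4 := by
      rw [hc, mul_one_div, div_le_div_iff₀ (by positivity) (by norm_num)]
      linarith
    linarith
  · rw [hgre]
    have := Finset.sum_nonneg fun ζ hζ => mul_nonneg hc0.le (hre u hu ζ hζ)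
    linarith
  · have hu : ζ ∈ closedBall (0 : ℂ) 1 := by simp [hZ ζ hζ]
    rw [hgre]
    have h1 := Finset.single_le_sum (fun ξ hξ => mul_nonneg hc0.le (hre ζ hu ξ hξ)) hζ
    have h2 : ((1 - c : ℝ) : ℂ) * ζ * conj ζ = ((1 - c : ℝ) : ℂ) := by
      rw [mul_assoc, Complex.mul_conj, Complex.normSq_eq_norm_sq, hZ ζ hζ]
      simp
    have h3 : (1 + ((1 - c : ℝ) : ℂ)) / (1 - ((1 - c : ℝ) : ℂ)) = (((2 - c) / c : ℝ) : ℂ) := by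
      push_cast
      ring
    simp only [h2, h3, Complex.ofReal_re] at h1
    have h4 : c * ((2 - c) / c) = 2 - c := by field_simp
    linarith

/-- An open set that contains the unit disc and all but finitely many points of the unit circle
receives a map `u ↦ u * ψ u` from the closed unit disc, whose derivative at the origin is large
compared with its supremum. -/
theorem exists_map_closedBall_into {Ω : Set ℂ} (hΩ : IsOpen Ω) (hD : ball 0 1 ⊆ Ω) (Z : Finset ℂ)
    (hZ : ∀ ζ : ℂ, ‖ζ‖ = 1 → ζ ∉ Z → ζ ∈ Ω) :
    ∃ δ > 0, ∃ ψ : ℂ → ℂ, (∀ u ∈ closedBall (0 : ℂ) 1, DifferentiableAt ℂ ψ u) ∧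
      (∀ u ∈ closedBall (0 : ℂ) 1, u * ψ u ∈ Ω) ∧
      (∀ u ∈ closedBall (0 : ℂ) 1, ‖u * ψ u‖ ≤ Real.exp δ) ∧ Real.exp (3 / 4 * δ) ≤ ‖ψ 0‖ := by
  obtain ⟨g, hgd, hg0, hg1, hgZ⟩ := exists_re_neg_on_finset (Z.filter fun ζ => ‖ζ‖ = 1)
    fun ζ hζ => (Finset.mem_filter.1 hζ).2
  have hgc : ContinuousOn g (closedBall 0 1) := fun u hu =>
    (hgd u hu).continuousAt.continuousWithinAt
  -- With `ψ = exp (δ g)`, points where `Re g < 0` are pushed into the open unit disc. The remaining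
  -- points form the compact set `K ⊆ Ω`, and for small `δ` they move by less than the thickening
  -- radius of `K`.
  set K : Set ℂ := closedBall (0 : ℂ) 1 ∩ g ⁻¹' {w | 0 ≤ w.re} with hK
  have hKc : IsCompact K := (isCompact_closedBall (0 : ℂ) 1).of_isClosed_subset
    (hgc.preimage_isClosed_of_isClosed isClosed_closedBall
      (isClosed_le continuous_const Complex.continuous_re)) Set.inter_subset_left
  have hKΩ : K ⊆ Ω := by
    rintro u ⟨hu, hu'⟩
    rcases lt_or_eq_of_le (show ‖u‖ ≤ 1 by simpa using hu) with h1 | h1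
    · exact hD (by simpa using h1)
    · refine hZ u h1 fun huZ => ?_
      exact (hgZ u (Finset.mem_filter.2 ⟨huZ, h1⟩)).not_ge hu'
  obtain ⟨ε, hε, hεΩ⟩ := hKc.exists_thickening_subset_open hΩ hKΩ
  obtain ⟨B, hB⟩ := (isCompact_closedBall (0 : ℂ) 1).exists_bound_of_continuousOn hgc
  have hB1 : 0 < max B 1 := by positivity
  set δ : ℝ := min 1 (ε / 3) / max B 1 with hδ
  have hδ0 : 0 < δ := by positivity
  have hδg : ∀ u ∈ closedBall (0 : ℂ) 1, ‖(δ : ℂ) * g u‖ ≤ min 1 (ε / 3) := by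
    intro u hu
    rw [norm_mul, Complex.norm_real, Real.norm_of_nonneg hδ0.le]
    calc δ * ‖g u‖ ≤ δ * max B 1 := by gcongr; exact (hB u hu).trans (le_max_left _ _)
      _ = min 1 (ε / 3) := by rw [hδ]; field_simp
  refine ⟨δ, hδ0, fun u => Complex.exp (δ * g u), fun u hu => ((hgd u hu).const_mul _).cexp,
    fun u hu => ?_, fun u hu => ?_, ?_⟩
  · have hu1 : ‖u‖ ≤ 1 := by simpa using hu
    by_cases hre : 0 ≤ (g u).re
    · refine hεΩ (mem_thickening_iff.2 ⟨u, ⟨hu, hre⟩, ?_⟩)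
      have h1 := Complex.norm_exp_sub_one_le ((hδg u hu).trans (min_le_left _ _))
      have h2 := (hδg u hu).trans (min_le_right _ _)
      rw [dist_eq_norm, show u * Complex.exp (δ * g u) - u = u * (Complex.exp (δ * g u) - 1) by ring,
        norm_mul]
      calc _ ≤ 1 * ‖Complex.exp (δ * g u) - 1‖ := by gcongr
        _ < ε := by linarith
    · refine hD ?_
      rw [mem_ball_zero_iff, norm_mul, Complex.norm_exp, Complex.re_ofReal_mul]
      have h1 : Real.exp (δ * (g u).re) < 1 :=
        Real.exp_lt_one_iff.2 (mul_neg_of_pos_of_neg hδ0 (not_le.1 hre))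
      nlinarith [norm_nonneg u, Real.exp_pos (δ * (g u).re)]
  · have hu1 : ‖u‖ ≤ 1 := by simpa using hu
    rw [norm_mul, Complex.norm_exp, Complex.re_ofReal_mul]
    calc _ ≤ 1 * Real.exp (δ * (g u).re) := by gcongr
      _ ≤ Real.exp δ := by
        rw [one_mul]
        exact Real.exp_le_exp.2 (mul_le_of_le_one_right hδ0.le (hg1 u hu))
  · rw [Complex.norm_exp, Complex.re_ofReal_mul, mul_comm δ]
    gcongr

/-- Cauchy's estimate for the lowest coefficient of a function composed with `u ↦ u * ψ u`. -/
theorem norm_coeff_zero_mul_pow_le {K : ℂ⟦X⟧} (hK : DiscConvergent K) {N : ℕ} {ψ E : ℂ → ℂ}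
    (hψ : DifferentiableAt ℂ ψ 0)
    (hE : ∀ u ∈ closedBall (0 : ℂ) 1, DifferentiableAt ℂ E u)
    (hEK : ∀ u, ‖u * ψ u‖ < 1 → E u = (u * ψ u) ^ N * discSum K (u * ψ u)) {B : ℝ}
    (hB : ∀ u : ℂ, ‖u‖ = 1 → ‖E u‖ ≤ B) :
    ‖PowerSeries.coeff 0 K‖ * ‖ψ 0‖ ^ N ≤ B := by
  -- The quotient `E u / u ^ N` with its removable singularity at 0 filled in. The maximum principle
  -- then bounds its value there by the supremum of `E` on the unit circle.
  set m : ℂ → ℂ := Function.update (fun u => E u / u ^ N) 0 (ψ 0 ^ N * discSum K 0) with hm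
  have hm0 : m =ᶠ[𝓝 0] fun u => ψ u ^ N * discSum K (u * ψ u) := by
    have h1 : ContinuousAt (fun u => ‖u * ψ u‖) 0 := (continuousAt_id.mul hψ.continuousAt).norm
    have h2 : ∀ᶠ u in 𝓝 (0 : ℂ), ‖u * ψ u‖ < 1 :=
      h1.eventually (gt_mem_nhds (by simp))
    filter_upwards [h2] with u hu
    rcases eq_or_ne u 0 with rfl | h0
    · simp [hm]
    · rw [hm, Function.update_of_ne h0, hEK u hu, mul_pow]
      field_simp
  have hmd : ∀ u ∈ closedBall (0 : ℂ) 1, DifferentiableAt ℂ m u := by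
    intro u hu
    rcases eq_or_ne u 0 with rfl | h0
    · refine DifferentiableAt.congr_of_eventuallyEq ?_ hm0
      refine (hψ.pow N).mul (DifferentiableAt.comp (g := discSum K) 0 ?_ (differentiableAt_id.mul hψ))
      exact hK.differentiableOn.differentiableAt (isOpen_ball.mem_nhds (by simp))
    · refine ((hE u hu).div (differentiableAt_id.pow N) (pow_ne_zero N h0)).congr_of_eventuallyEq ?_
      filter_upwards [isOpen_ne.mem_nhds h0] with w hw
      simp [hm, Function.update_of_ne hw]
  have hmc : DiffContOnCl ℂ m (ball 0 1) := by
    refine DifferentiableOn.diffContOnCl fun u hu => ?_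
    rw [closure_ball _ one_ne_zero] at hu
    exact (hmd u hu).differentiableWithinAt
  have h := Complex.norm_le_of_forall_mem_frontier_norm_le isBounded_ball hmc (C := B)
    (fun u hu => ?_) (subset_closure (mem_ball_self one_pos))
  · rw [hm, Function.update_self, DiscConvergent.discSum_zero_right, norm_mul, norm_pow,
      mul_comm] at h
    exact h
  · rw [frontier_ball _ one_ne_zero, mem_sphere_zero_iff_norm] at hu
    have h0 : u ≠ 0 := by rintro rfl; simp at hu
    rw [hm, Function.update_of_ne h0, norm_div, norm_pow, hu, one_pow, div_one]
    exact hB u hu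

end Reparametrization

/-! ### Integer coefficients, Padé approximants and rationality. -/

section Rationality

open Metric
open scoped Topology Polynomial

attribute [local instance] Matrix.seminormedAddCommGroup in
/-- Siegel's lemma for Padé approximants: an integer polynomial of degree less than `2 * e` whose
product with a given power series has vanishing coefficients in degrees `2 * e, …, 3 * e - 1`. -/
theorem exists_int_vec_sum_eq_zero {a : ℕ → ℤ} {e : ℕ} (he : 0 < e) {A : ℝ} (hA1 : 1 ≤ A)
    (hA : ∀ n < 3 * e, |(a n : ℝ)| ≤ A) :
    ∃ q : Fin (2 * e) → ℤ, q ≠ 0 ∧ (∀ i, |(q i : ℝ)| ≤ 2 * e * A) ∧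
      ∀ j < e, ∑ i, q i * a (2 * e + j - i) = 0 := by
  set T : Matrix (Fin e) (Fin (2 * e)) ℤ := Matrix.of fun j i => a (2 * e + j - i) with hT
  obtain ⟨q, hq0, hq, hqn⟩ := Int.Matrix.exists_ne_zero_int_vec_norm_le T
    (by simp only [Fintype.card_fin]; omega) (by simpa using he)
  have hTA : ‖T‖ ≤ A := by
    refine (Matrix.norm_le_iff (by linarith)).2 fun j i => ?_
    rw [Int.norm_eq_abs]
    exact hA _ (by omega)
  have he' : (0 : ℝ) < e := by exact_mod_cast he
  -- With `e` equations in `2 * e` unknowns, Siegel's exponent is `e / (2 * e - e) = 1`.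
  have hexp : ((Fintype.card (Fin e) : ℝ) /
      ((Fintype.card (Fin (2 * e)) : ℝ) - Fintype.card (Fin e))) = 1 := by
    simp only [Fintype.card_fin]
    push_cast
    rw [div_eq_one_iff_eq (by linarith)]
    ring
  rw [hexp, Real.rpow_one, Fintype.card_fin] at hqn
  refine ⟨q, hq0, fun i => ?_, fun j hj => ?_⟩
  · rw [← Int.norm_eq_abs]
    refine (norm_le_pi_norm q i).trans (hqn.trans ?_)
    push_cast
    gcongr
    exact max_le hA1 hTA
  · have h1 := congrFun hq ⟨j, hj⟩
    simpa [Matrix.mulVec, dotProduct, hT, mul_comm] using h1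

theorem norm_eval_le {P : ℂ[X]} {m : ℕ} (hP : P.natDegree < m) {b R : ℝ}
    (hb : ∀ n, ‖P.coeff n‖ ≤ b) (hR : 1 ≤ R) {w : ℂ} (hw : ‖w‖ ≤ R) :
    ‖P.eval w‖ ≤ m * (b * R ^ m) := by
  have hb0 : 0 ≤ b := (norm_nonneg _).trans (hb 0)
  rw [Polynomial.eval_eq_sum_range' hP]
  refine (norm_sum_le _ _).trans ((Finset.sum_le_card_nsmul _ _ (b * R ^ m) fun i hi => ?_).trans
    (by simp))
  rw [norm_mul, norm_pow]
  gcongr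
  · exact hb i
  · calc ‖w‖ ^ i ≤ R ^ i := by gcongr
      _ ≤ R ^ m := pow_le_pow_right₀ hR (Finset.mem_range.1 hi).le

/-- The power series with integer coefficients `a`. -/
def intSeries (a : ℕ → ℤ) : ℂ⟦X⟧ := PowerSeries.mk fun n => (a n : ℂ)

open PowerSeries in
/-- If the Padé approximant built from integers does not represent the series, its remainder has a
nonzero integer as lowest coefficient. -/
theorem exists_pade_approximant {a : ℕ → ℤ} {e : ℕ} (he : 0 < e) {A : ℝ} (hA1 : 1 ≤ A)
    (hA : ∀ n < 3 * e, |(a n : ℝ)| ≤ A) :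
    ∃ Q P : ℂ[X], Q ≠ 0 ∧ Q.natDegree < 2 * e ∧ P.natDegree < 2 * e ∧
      (∀ n, ‖Q.coeff n‖ ≤ 2 * e * A) ∧ (∀ n, ‖P.coeff n‖ ≤ 2 * e * (2 * e * A * A)) ∧
      ((Q : ℂ⟦X⟧) * intSeries a = P ∨ ∃ N, 3 * e ≤ N ∧ ∃ K : ℂ⟦X⟧,
        (Q : ℂ⟦X⟧) * intSeries a - (P : ℂ⟦X⟧) = X ^ N * K ∧ 1 ≤ ‖coeff 0 K‖) := by
  obtain ⟨q, hq0, hq, hqa⟩ := exists_int_vec_sum_eq_zero he hA1 hA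
  have hA0 : 0 ≤ A := by linarith
  set q' : ℕ → ℤ := fun i => if h : i < 2 * e then q ⟨i, h⟩ else 0 with hq'
  have hq'b : ∀ i, ‖(q' i : ℂ)‖ ≤ 2 * e * A := by
    intro i
    rw [Complex.norm_intCast]
    simp only [hq']
    split_ifs with h
    · exact hq _
    · simp only [Int.cast_zero, abs_zero]
      positivity
  set Q : ℂ[X] := ∑ i ∈ Finset.range (2 * e), Polynomial.monomial i (q' i : ℂ) with hQ
  have hQc : ∀ n, Q.coeff n = q' n := by
    intro n
    simp only [hQ, Polynomial.finsetSum_coeff, Polynomial.coeff_monomial, Finset.sum_ite_eq',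
      Finset.mem_range]
    split_ifs with h
    · rfl
    · simp [hq', h]
  have hQF : ∀ n, coeff n ((Q : ℂ⟦X⟧) * intSeries a) =
      ((∑ i ∈ Finset.range (n + 1), q' i * a (n - i) : ℤ) : ℂ) := by
    intro n
    rw [coeff_mul, Finset.Nat.sum_antidiagonal_eq_sum_range_succ_mk]
    push_cast
    refine Finset.sum_congr rfl fun i _ => ?_
    simp [hQc, intSeries]
  have hQF0 : ∀ n, 2 * e ≤ n → n < 3 * e → coeff n ((Q : ℂ⟦X⟧) * intSeries a) = 0 := by
    intro n h1 h2
    have h3 := hqa (n - 2 * e) (by omega)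
    rw [show 2 * e + (n - 2 * e) = n by omega] at h3
    rw [hQF, ← Finset.sum_subset (Finset.range_mono (show 2 * e ≤ n + 1 by omega)) fun i _ hi => ?_,
      Finset.sum_range, Int.cast_eq_zero, ← h3]
    · exact Finset.sum_congr rfl fun i _ => by simp [hq']
    · rw [Finset.mem_range] at hi
      simp [hq', hi]
  set P : ℂ[X] := trunc (2 * e) ((Q : ℂ⟦X⟧) * intSeries a) with hP
  have hPc : ∀ n, P.coeff n = if n < 2 * e then coeff n ((Q : ℂ⟦X⟧) * intSeries a) else 0 :=
    fun n => coeff_trunc _ _ _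
  have hdeg : ∀ R : ℂ[X], (∀ n, 2 * e ≤ n → R.coeff n = 0) → R.natDegree < 2 * e := by
    intro R hR
    by_contra! h
    have h1 := hR _ h
    rw [Polynomial.coeff_natDegree, Polynomial.leadingCoeff_eq_zero] at h1
    simp only [h1, Polynomial.natDegree_zero] at h
    omega
  refine ⟨Q, P, ?_, ?_, ?_, fun n => hQc n ▸ hq'b n, fun n => ?_, ?_⟩
  · intro h
    refine hq0 (funext fun i => ?_)
    have h1 := hQc i
    rw [h, Polynomial.coeff_zero] at h1
    have h2 : q' i = 0 := by exact_mod_cast h1.symm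
    simpa [hq'] using h2
  · refine hdeg Q fun n hn => ?_
    simp [hQc, hq', hn]
  · refine hdeg P fun n hn => ?_
    rw [hPc, if_neg (by omega)]
  · rw [hPc]
    split_ifs with h
    · rw [hQF]
      push_cast
      refine (norm_sum_le _ _).trans ((Finset.sum_le_card_nsmul _ _ (2 * e * A * A)
        fun i hi => ?_).trans ?_)
      · rw [norm_mul]
        refine mul_le_mul (hq'b i) ?_ (norm_nonneg _) (by positivity)
        rw [Complex.norm_intCast]
        exact hA _ (by omega)
      · rw [Finset.card_range, nsmul_eq_mul]
        gcongr
        exact_mod_cast h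
    · rw [norm_zero]
      positivity
  · rw [or_iff_not_imp_left]
    intro hne
    have h0 : (Q : ℂ⟦X⟧) * intSeries a - (P : ℂ⟦X⟧) ≠ 0 := sub_ne_zero.2 hne
    obtain ⟨N, hN⟩ : ∃ N : ℕ, ((Q : ℂ⟦X⟧) * intSeries a - (P : ℂ⟦X⟧)).order = N :=
      ⟨_, (ENat.natCast_toNat (order_eq_top.not.2 h0)).symm⟩
    obtain ⟨K, hK⟩ := X_pow_dvd_iff.2 fun m (hm : m < N) =>
      coeff_of_lt_order m (hN ▸ (by exact_mod_cast hm) :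
        (m : ℕ∞) < ((Q : ℂ⟦X⟧) * intSeries a - (P : ℂ⟦X⟧)).order)
    have hNc : coeff N ((Q : ℂ⟦X⟧) * intSeries a - (P : ℂ⟦X⟧)) ≠ 0 := ((order_eq_nat.1 hN).1)
    have hc : ∀ n, coeff n ((Q : ℂ⟦X⟧) * intSeries a - (P : ℂ⟦X⟧)) =
        coeff n ((Q : ℂ⟦X⟧) * intSeries a) - P.coeff n := fun n => by
      rw [map_sub, Polynomial.coeff_coe]
    -- Degrees below `2 * e` are cancelled by the truncation `P`, those from `2 * e` to `3 * e - 1`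
    -- by the choice of `q`.
    have hN3 : 3 * e ≤ N := by
      by_contra! h
      refine hNc ?_
      rw [hc, hPc]
      split_ifs with h2
      · simp
      · rw [hQF0 N (by omega) h, sub_zero]
    refine ⟨N, hN3, K, hK, ?_⟩
    have h1 : coeff 0 K = coeff N ((Q : ℂ⟦X⟧) * intSeries a - (P : ℂ⟦X⟧)) := by
      rw [hK]
      simpa using (coeff_X_pow_mul K N 0).symm
    have h2 := hNc
    rw [hc, hPc, if_neg (by omega), sub_zero, hQF] at h1 h2
    rw [h1, Complex.norm_intCast]
    exact_mod_cast Int.one_le_abs (by exact_mod_cast h2)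

/-- A power series with integer coefficients of subexponential growth is rational as soon as its sum
extends across all but finitely many points of the unit circle. -/
theorem exists_polynomial_mul_intSeries_eq {a : ℕ → ℤ}
    (ha : ∀ x : ℝ, 1 < x → ∃ C : ℝ, ∀ n, |(a n : ℝ)| ≤ C * x ^ n)
    (Z : Finset ℂ) (hZ : ∀ ζ : ℂ, ‖ζ‖ = 1 → ζ ∉ Z → ExtendsAt (discSum (intSeries a)) ζ) :
    ∃ Q P : ℂ[X], Q ≠ 0 ∧ (Q : ℂ⟦X⟧) * intSeries a = P := by
  have hF : DiscConvergent (intSeries a) := DiscConvergent.of_norm_coeff_le fun x hx => by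
    simpa [intSeries] using ha x hx
  obtain ⟨Ω, f, hΩ, hDΩ, hAΩ, hfd, hf⟩ := exists_extension hF.differentiableOn
    {ζ : ℂ | ‖ζ‖ = 1 ∧ ζ ∉ Z} fun ζ hζ => ⟨hζ.1, hZ ζ hζ.1 hζ.2⟩
  obtain ⟨δ, hδ, ψ, hψ, hψΩ, hψδ, hψ0⟩ := exists_map_closedBall_into hΩ hDΩ Z
    fun ζ h1 h2 => hAΩ ⟨h1, h2⟩
  have hφd : ∀ u ∈ closedBall (0 : ℂ) 1, DifferentiableAt ℂ (fun u => u * ψ u) u := fun u hu =>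
    differentiableAt_id.mul (hψ u hu)
  have hfφ : ∀ u ∈ closedBall (0 : ℂ) 1, DifferentiableAt ℂ (fun u => f (u * ψ u)) u :=
    fun u hu => ((hfd.differentiableAt (hΩ.mem_nhds (hψΩ u hu))).comp u (hφd u hu) :)
  obtain ⟨B, hB⟩ := (isCompact_closedBall (0 : ℂ) 1).exists_bound_of_continuousOn
    (f := fun u => f (u * ψ u)) fun u hu => (hfφ u hu).continuousAt.continuousWithinAt
  have hB0 : 0 ≤ B := (norm_nonneg _).trans (hB 0 (by simp))
  -- With `x = exp (δ / 48)` all exponents are integers: the lower bound is `x ^ (36 * 3e) = x ^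
  -- (108e)`. The upper bound has `x ^ (48 * 2e)` from the degrees and `x ^ (6e)` from `A ^ 2`, in
  -- total `x ^ (102e)`. The surplus `x ^ (6e)` must beat the factor `8 (B + 1) C² e³`, which
  -- determines `e`.
  obtain ⟨C₀, hC₀⟩ := ha (Real.exp (δ / 48)) (Real.one_lt_exp_iff.2 (by positivity))
  set C : ℝ := max C₀ 1
  have hC1 : 1 ≤ C := le_max_right _ _
  obtain ⟨e, he, hlarge⟩ : ∃ e : ℕ, 0 < e ∧
      8 * (B + 1) * C ^ 2 * (e : ℝ) ^ 3 < Real.exp (δ / 8) ^ e := by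
    have h1 := tendsto_pow_const_div_const_pow_of_one_lt 3
      (Real.one_lt_exp_iff.2 (show 0 < δ / 8 by positivity))
    have h2 : (0 : ℝ) < 8 * (B + 1) * C ^ 2 := by positivity
    obtain ⟨e, h3, h4⟩ := ((h1.eventually (gt_mem_nhds
      (show (0 : ℝ) < 1 / (8 * (B + 1) * C ^ 2) by positivity))).and (eventually_gt_atTop 0)).exists
    refine ⟨e, h4, ?_⟩
    rw [div_lt_div_iff₀ (by positivity) h2] at h3
    linarith
  set x : ℝ := Real.exp (δ / 48) with hx
  have hx1 : 1 ≤ x := Real.one_le_exp (by positivity)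
  have hxδ : Real.exp δ = x ^ 48 := by rw [hx, ← Real.exp_nat_mul]; congr 1; push_cast; ring
  have hxδ1 : Real.exp (3 / 4 * δ) = x ^ 36 := by
    rw [hx, ← Real.exp_nat_mul]; congr 1; push_cast; ring
  have hxδ2 : Real.exp (δ / 8) = x ^ 6 := by
    rw [hx, ← Real.exp_nat_mul]; congr 1; push_cast; ring
  rw [hxδ2] at hlarge
  rw [hxδ1] at hψ0
  rw [hxδ] at hψδ
  set A : ℝ := C * x ^ (3 * e) with hA
  have hA1 : 1 ≤ A := one_le_mul_of_one_le_of_one_le hC1 (one_le_pow₀ hx1)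
  obtain ⟨Q, P, hQ0, hQd, hPd, hQb, hPb, h | ⟨N, hN, K, hK, hK1⟩⟩ :=
    exists_pade_approximant he hA1 fun n hn => (hC₀ n).trans (by
      rw [hA]
      gcongr
      exact le_max_left _ _)
  · exact ⟨Q, P, hQ0, h⟩
  exfalso
  have hKc : DiscConvergent K := by
    refine DiscConvergent.of_X_pow_mul (N := N) ?_
    rw [← hK]
    exact ((DiscConvergent.of_polynomial Q).mul hF).sub (DiscConvergent.of_polynomial P)
  have hx48 : 1 ≤ x ^ 48 := one_le_pow₀ hx1
  have hlow := norm_coeff_zero_mul_pow_le hKc (N := N) (ψ := ψ)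
    (E := fun u => Q.eval (u * ψ u) * f (u * ψ u) - P.eval (u * ψ u))
    (hψ 0 (by simp))
    (fun u hu => (((Q.differentiable _).comp u (hφd u hu)).mul (hfφ u hu)).sub
      ((P.differentiable _).comp u (hφd u hu)))
    (fun u hu => by
      have h1 := congrArg (fun G => discSum G (u * ψ u)) hK
      rw [DiscConvergent.discSum_sub ((DiscConvergent.of_polynomial Q).mul hF)
        (DiscConvergent.of_polynomial P) hu, DiscConvergent.discSum_mul
        (DiscConvergent.of_polynomial Q) hF hu, DiscConvergent.discSum_polynomial,
        DiscConvergent.discSum_polynomial, ← Polynomial.coe_X, ← Polynomial.coe_pow,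
        DiscConvergent.discSum_mul (DiscConvergent.of_polynomial _) hKc hu,
        DiscConvergent.discSum_polynomial] at h1
      rw [hf _ (by simpa using hu), h1]
      simp)
    (B := 8 * (B + 1) * (e : ℝ) ^ 3 * A ^ 2 * (x ^ 48) ^ (2 * e)) (fun u hu => by
      have hu' : u ∈ closedBall (0 : ℂ) 1 := by simp [hu]
      have h1 := norm_eval_le hQd hQb hx48 (hψδ u hu')
      have h2 := norm_eval_le hPd hPb hx48 (hψδ u hu')
      have he1 : (1 : ℝ) ≤ e := by exact_mod_cast he
      have he0 : (0 : ℝ) ≤ e := by positivity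
      have h3 : 4 * (e : ℝ) ^ 2 * A * B ≤ 8 * e ^ 3 * A ^ 2 * B := by
        have h5 : (e : ℝ) ^ 2 ≤ e ^ 3 := pow_le_pow_right₀ he1 (by norm_num)
        have h6 : A ≤ A ^ 2 := by nlinarith
        gcongr
        norm_num
      push_cast at h1 h2
      calc _ ≤ ‖Q.eval (u * ψ u)‖ * ‖f (u * ψ u)‖ + ‖P.eval (u * ψ u)‖ :=
            (norm_sub_le _ _).trans (by rw [norm_mul])
        _ ≤ 2 * e * (2 * e * A * (x ^ 48) ^ (2 * e)) * B +
            2 * e * (2 * e * (2 * e * A * A) * (x ^ 48) ^ (2 * e)) := by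
            gcongr
            exact hB u hu'
        _ = (4 * (e : ℝ) ^ 2 * A * B + 8 * e ^ 3 * A ^ 2) * (x ^ 48) ^ (2 * e) := by ring
        _ ≤ (8 * (e : ℝ) ^ 3 * A ^ 2 * B + 8 * e ^ 3 * A ^ 2) * (x ^ 48) ^ (2 * e) := by gcongr
        _ = _ := by ring)
  have hlow' : x ^ (108 * e) ≤ 8 * (B + 1) * (e : ℝ) ^ 3 * A ^ 2 * (x ^ 48) ^ (2 * e) := by
    refine le_trans ?_ hlow
    calc x ^ (108 * e) = (x ^ 36) ^ (3 * e) := by ring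
      _ ≤ (x ^ 36) ^ N := pow_le_pow_right₀ (one_le_pow₀ hx1) hN
      _ ≤ ‖ψ 0‖ ^ N := by gcongr
      _ ≤ _ := le_mul_of_one_le_left (by positivity) hK1
  have hA2 : A ^ 2 * (x ^ 48) ^ (2 * e) = C ^ 2 * x ^ (102 * e) := by
    rw [hA]
    ring
  have h3 : x ^ (108 * e) = (x ^ 6) ^ e * x ^ (102 * e) := by ring
  have h4 : 0 < x ^ (102 * e) := by positivity
  rw [mul_assoc _ (A ^ 2), hA2, h3, ← mul_assoc] at hlow'
  have := le_of_mul_le_mul_right hlow' h4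
  linarith

end Rationality

/-! ### From holonomicity to a differential equation. -/

section Holonomic

open PowerSeries Metric
open scoped Polynomial

/-- A holonomic power series satisfies a linear differential equation of positive order with
polynomial coefficients. -/
theorem IsHolonomic.exists_ode {F : ℂ⟦X⟧} (hF : IsHolonomic F) :
    ∃ r : ℕ, 0 < r ∧ ∃ p : ℕ → ℂ[X], p r ≠ 0 ∧
      ∑ j ∈ Finset.range (r + 1), (p j : ℂ⟦X⟧) * (PowerSeries.derivative ℂ)^[j] F = 0 := by
  -- Starting from the first derivative guarantees that the resulting equation has positive order.
  set v : ℕ → ℂ⸨X⸩ := fun k =>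
    HahnSeries.ofPowerSeries ℤ ℂ ((PowerSeries.derivative ℂ)^[k + 1] F) with hv
  have h1 : ¬ LinearIndependent (RatFunc ℂ) v := by
    intro h
    set V := Submodule.span (RatFunc ℂ) (Set.range fun k : ℕ =>
      HahnSeries.ofPowerSeries ℤ ℂ ((PowerSeries.derivative ℂ)^[k] F))
    have : FiniteDimensional (RatFunc ℂ) V := hF
    have h2 : LinearIndependent (RatFunc ℂ)
        (fun k => (⟨v k, Submodule.subset_span ⟨k + 1, rfl⟩⟩ : V)) :=
      LinearIndependent.of_comp V.subtype h
    exact not_finite_iff_infinite.2 inferInstance h2.finite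
  -- Clearing denominators: dependence over the rational functions is dependence over the
  -- polynomials.
  rw [← LinearIndependent.iff_fractionRing ℂ[X] (RatFunc ℂ), linearIndependent_iff] at h1
  push Not at h1
  obtain ⟨l, hl, hl0⟩ := h1
  obtain ⟨s, hs⟩ : ∃ s, s = l.support.max' (Finsupp.support_nonempty_iff.2 hl0) := ⟨_, rfl⟩
  refine ⟨s + 1, s.succ_pos, fun j => if j = 0 then 0 else l (j - 1), ?_, ?_⟩
  · change l s ≠ 0
    rw [hs]
    exact Finsupp.mem_support_iff.1 (Finset.max'_mem _ _)
  · rw [Finset.sum_range_succ']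
    simp only [Nat.add_sub_cancel, Nat.succ_ne_zero, if_false, if_true, Polynomial.coe_zero,
      zero_mul, add_zero]
    refine HahnSeries.ofPowerSeries_injective (Γ := ℤ) ?_
    rw [map_zero, ← hl, Finsupp.linearCombination_apply,
      Finsupp.sum_of_support_subset l (s := Finset.range (s + 1)) (fun i hi => by
        rw [Finset.mem_range, Nat.lt_succ_iff, hs]
        exact Finset.le_max' _ _ hi) (fun i a => a • v i) (fun i _ => by
          rw [Algebra.smul_def, map_zero, zero_mul]), map_sum]
    refine Finset.sum_congr rfl fun i _ => ?_
    rw [map_mul, Algebra.smul_def, RatFunc.coe_coe, IsScalarTower.algebraMap_apply ℂ[X] (RatFunc ℂ)]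
    rfl

/-- Sums of holonomic series extend across all but finitely many points of the unit circle. -/
theorem IsHolonomic.exists_extendsAt {F : ℂ⟦X⟧} (hF : IsHolonomic F) (hFc : DiscConvergent F) :
    ∃ Z : Finset ℂ, ∀ ζ : ℂ, ‖ζ‖ = 1 → ζ ∉ Z → ExtendsAt (discSum F) ζ := by
  obtain ⟨r, hr, p, hp, hsum⟩ := hF.exists_ode
  refine ⟨(p r).roots.toFinset, fun ζ hζ hζZ =>
    extendsAt_of_linear_ode hFc.differentiableOn hr p (fun z hz => ?_) hζ fun h0 => hζZ ?_⟩
  · have hz' : ‖z‖ < 1 := by simpa using hz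
    have hterm : ∀ j, DiscConvergent ((p j : ℂ⟦X⟧) * (PowerSeries.derivative ℂ)^[j] F) := fun j =>
      (DiscConvergent.of_polynomial (p j)).mul (hFc.iterate_derivative j)
    have h1 : ∀ n, DiscConvergent (∑ j ∈ Finset.range n,
          (p j : ℂ⟦X⟧) * (PowerSeries.derivative ℂ)^[j] F) ∧
        discSum (∑ j ∈ Finset.range n, (p j : ℂ⟦X⟧) * (PowerSeries.derivative ℂ)^[j] F) z =
          ∑ j ∈ Finset.range n, (p j).eval z * iteratedDeriv j (discSum F) z := by
      intro n
      induction n with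
      | zero => exact ⟨by simpa using DiscConvergent.of_polynomial 0, by simp [discSum]⟩
      | succ n ih =>
        rw [Finset.sum_range_succ, Finset.sum_range_succ, ih.1.discSum_add (hterm n) hz', ih.2,
          (DiscConvergent.of_polynomial (p n)).discSum_mul (hFc.iterate_derivative n) hz',
          DiscConvergent.discSum_polynomial, hFc.discSum_iterate_derivative n hz']
        exact ⟨ih.1.add (hterm n), rfl⟩
    rw [← (h1 (r + 1)).2, hsum]
    simp [discSum]
  · rw [Multiset.mem_toFinset, Polynomial.mem_roots hp]
    exact h0

end Holonomic

/-! ### Polynomial growth of the coefficients of rational series. -/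

section PolynomialGrowth

open PowerSeries
open scoped Polynomial

/-- The coefficients of the power series grow at most polynomially. -/
def PolynomiallyBounded (F : ℂ⟦X⟧) : Prop :=
  ∃ (C : ℝ) (d : ℕ), 0 ≤ C ∧ ∀ n, ‖coeff n F‖ ≤ C * ((n : ℝ) + 1) ^ d

theorem PolynomiallyBounded.of_polynomial (P : ℂ[X]) : PolynomiallyBounded (P : ℂ⟦X⟧) := by
  refine ⟨∑ i ∈ P.support, ‖P.coeff i‖, 0, Finset.sum_nonneg fun _ _ => norm_nonneg _, fun n => ?_⟩
  rw [pow_zero, mul_one, Polynomial.coeff_coe]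
  by_cases h : n ∈ P.support
  · exact Finset.single_le_sum (f := fun i => ‖P.coeff i‖) (fun _ _ => norm_nonneg _) h
  · rw [Polynomial.notMem_support_iff.1 h, norm_zero]
    exact Finset.sum_nonneg fun _ _ => norm_nonneg _

/-- If `H` denotes the product, then `ρ f_{n+1} = f_n - h_{n+1}`. As `|ρ| ≥ 1`, the coefficients of
`F` are bounded by partial sums of those of `H`, which costs one degree. -/
theorem PolynomiallyBounded.of_X_sub_C_mul {F : ℂ⟦X⟧} {ρ : ℂ} (hρ : 1 ≤ ‖ρ‖)
    (h : PolynomiallyBounded (((Polynomial.X - Polynomial.C ρ : ℂ[X]) : ℂ⟦X⟧) * F)) :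
    PolynomiallyBounded F := by
  obtain ⟨B, d, hB0, hB⟩ := h
  have hle : ∀ n, ‖coeff n F‖ ≤ ‖ρ * coeff n F‖ := fun n => by
    rw [norm_mul]
    exact le_mul_of_one_le_left (norm_nonneg _) hρ
  refine ⟨B, d + 1, hB0, fun n => ?_⟩
  induction n with
  | zero =>
    have h1 := hB 0
    simp only [Polynomial.coe_sub, Polynomial.coe_X, Polynomial.coe_C, sub_mul, map_sub,
      coeff_zero_X_mul, coeff_C_mul, zero_sub, norm_neg] at h1
    simpa using (hle 0).trans h1
  | succ n ih =>
    have h1 := hB (n + 1)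
    simp only [Polynomial.coe_sub, Polynomial.coe_X, Polynomial.coe_C, sub_mul, map_sub,
      coeff_succ_X_mul, coeff_C_mul] at h1
    have h2 : ‖ρ * coeff (n + 1) F‖ ≤ ‖coeff n F‖ + ‖coeff n F - ρ * coeff (n + 1) F‖ := by
      rw [norm_sub_rev]
      exact norm_le_norm_add_norm_sub' _ _
    have h3 : B * ((n : ℝ) + 1) ^ (d + 1) ≤ B * ((n : ℝ) + 1) * (((n + 1 : ℕ) : ℝ) + 1) ^ d := by
      rw [pow_succ', ← mul_assoc]
      gcongr
      linarith
    calc ‖coeff (n + 1) F‖ ≤ _ := hle _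
      _ ≤ _ := h2
      _ ≤ B * ((n : ℝ) + 1) * (((n + 1 : ℕ) : ℝ) + 1) ^ d + B * (((n + 1 : ℕ) : ℝ) + 1) ^ d :=
          add_le_add (ih.trans h3) h1
      _ = B * (((n + 1 : ℕ) : ℝ) + 1) ^ (d + 1) := by push_cast; ring

/-- Over `ℂ` the factor `Q` splits, so its roots can be divided out one at a time. -/
theorem PolynomiallyBounded.of_polynomial_mul {Q : ℂ[X]} (hQ : Q ≠ 0)
    (hroots : ∀ ρ, Q.IsRoot ρ → 1 ≤ ‖ρ‖) {F : ℂ⟦X⟧}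
    (h : PolynomiallyBounded ((Q : ℂ⟦X⟧) * F)) : PolynomiallyBounded F := by
  induction hn : Q.natDegree generalizing Q with
  | zero =>
    obtain ⟨c, rfl⟩ : ∃ c, Q = Polynomial.C c := ⟨_, Polynomial.eq_C_of_natDegree_eq_zero hn⟩
    have hc : c ≠ 0 := by rintro rfl; simp at hQ
    obtain ⟨B, d, hB0, hB⟩ := h
    refine ⟨‖c‖⁻¹ * B, d, by positivity, fun n => ?_⟩
    have h1 := hB n
    rw [Polynomial.coe_C, coeff_C_mul, norm_mul] at h1
    rw [mul_assoc, le_inv_mul_iff₀ (norm_pos_iff.2 hc)]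
    exact h1
  | succ n ih =>
    obtain ⟨ρ, hρ⟩ := IsAlgClosed.exists_root Q fun h0 => by
      have := Polynomial.natDegree_eq_zero_iff_degree_le_zero.2 h0.le
      omega
    obtain ⟨R, rfl⟩ := Polynomial.dvd_iff_isRoot.2 hρ
    have hR : R ≠ 0 := right_ne_zero_of_mul hQ
    refine ih hR (fun ξ hξ => hroots ξ ?_) ?_ ?_
    · rw [Polynomial.IsRoot, Polynomial.eval_mul, hξ.eq_zero, mul_zero]
    · rw [Polynomial.coe_mul, mul_assoc] at h
      exact h.of_X_sub_C_mul (hroots ρ hρ)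
    · rw [Polynomial.natDegree_mul (Polynomial.X_sub_C_ne_zero ρ) hR,
        Polynomial.natDegree_X_sub_C] at hn
      omega

/-- A rational power series that converges on the unit disc has polynomially bounded
coefficients. -/
theorem DiscConvergent.polynomiallyBounded {F : ℂ⟦X⟧} (hF : DiscConvergent F) {Q P : ℂ[X]}
    (hQ : Q ≠ 0) (h : (Q : ℂ⟦X⟧) * F = P) : PolynomiallyBounded F := by
  induction hn : Q.natDegree using Nat.strong_induction_on generalizing Q P with
  | _ n ih =>
    by_cases hroots : ∀ ρ, Q.IsRoot ρ → 1 ≤ ‖ρ‖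
    · exact PolynomiallyBounded.of_polynomial_mul hQ hroots (h ▸ .of_polynomial P)
    push Not at hroots
    obtain ⟨ρ, hρ, hρ1⟩ := hroots
    -- Convergence at `ρ` allows evaluating `Q F = P` there, so a root of `Q` in the open disc is
    -- also a root of `P` and can be cancelled.
    have hP : P.IsRoot ρ := by
      rw [Polynomial.IsRoot, ← DiscConvergent.discSum_polynomial, ← h,
        (DiscConvergent.of_polynomial Q).discSum_mul hF hρ1, DiscConvergent.discSum_polynomial,
        hρ.eq_zero, zero_mul]
    obtain ⟨R, rfl⟩ := Polynomial.dvd_iff_isRoot.2 hρ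
    obtain ⟨T, rfl⟩ := Polynomial.dvd_iff_isRoot.2 hP
    have hR : R ≠ 0 := right_ne_zero_of_mul hQ
    have hX : ((Polynomial.X - Polynomial.C ρ : ℂ[X]) : ℂ⟦X⟧) ≠ 0 := by
      rw [Ne, Polynomial.coe_eq_zero_iff]
      exact Polynomial.X_sub_C_ne_zero ρ
    rw [Polynomial.coe_mul, Polynomial.coe_mul, mul_assoc] at h
    refine ih R.natDegree ?_ hR (mul_left_cancel₀ hX h) rfl
    rw [← hn, Polynomial.natDegree_mul (Polynomial.X_sub_C_ne_zero ρ) hR,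
      Polynomial.natDegree_X_sub_C]
    omega

theorem isRationalSeries_of_polynomial_mul_eq {F : ℂ⟦X⟧} {Q P : ℂ[X]} (hQ : Q ≠ 0)
    (h : (Q : ℂ⟦X⟧) * F = P) : IsRationalSeries F := by
  have hcoe : ∀ R : ℂ[X], algebraMap (RatFunc ℂ) ℂ⸨X⸩ (algebraMap ℂ[X] (RatFunc ℂ) R) =
      HahnSeries.ofPowerSeries ℤ ℂ (R : ℂ⟦X⟧) := fun R => (RatFunc.coe_coe R).symm
  refine ⟨algebraMap ℂ[X] (RatFunc ℂ) P / algebraMap ℂ[X] (RatFunc ℂ) Q, ?_⟩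
  have hQ0 : HahnSeries.ofPowerSeries ℤ ℂ (Q : ℂ⟦X⟧) ≠ 0 := by
    rw [Ne, map_eq_zero_iff _ HahnSeries.ofPowerSeries_injective, Polynomial.coe_eq_zero_iff]
    exact hQ
  rw [map_div₀, hcoe, hcoe, div_eq_iff hQ0, ← h, map_mul, mul_comm]

theorem GeodesicGrowth.hasPolynomialGeodesicGrowth_of_polynomiallyBounded {G : Type*} [Group G]
    {S : Finset G} {ω : S → ℕ+} (h : PolynomiallyBounded (geodesicGrowthSeries ω)) :
    HasPolynomialGeodesicGrowth ω := by
  obtain ⟨C, d, hC, hb⟩ := h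
  obtain ⟨β, hβ⟩ := exists_nat_ge (C * 2 ^ d)
  -- The increments make both constants positive; `n + 1 ≤ 2 * n` accounts for the factor `2 ^ d` in
  -- `β`.
  refine ⟨β + 1, d + 1, by omega, by omega, fun n hn => ?_⟩
  have h1 := hb n
  simp only [geodesicGrowthSeries, coeff_mk, Complex.norm_natCast] at h1
  have hn' : (1 : ℝ) ≤ n := by exact_mod_cast hn
  have h2 : (geodesicGrowth ω n : ℝ) ≤ ((β + 1 : ℕ) : ℝ) * (n : ℝ) ^ (d + 1) := by
    calc (geodesicGrowth ω n : ℝ) ≤ C * ((n : ℝ) + 1) ^ d := h1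
      _ ≤ C * (2 * (n : ℝ)) ^ d := by gcongr; linarith
      _ = C * 2 ^ d * (n : ℝ) ^ d := by rw [mul_pow]; ring
      _ ≤ ((β + 1 : ℕ) : ℝ) * (n : ℝ) ^ (d + 1) := by
        gcongr
        · push_cast
          linarith
        · omega
  exact_mod_cast h2

end PolynomialGrowth

end

theorem mainTheorem4 {G : Type*} [Group G] (S : Finset G)
    (hS : Submonoid.closure (S : Set G) = ⊤) (ω : S → ℕ+)
    (hf : IsHolonomic (GeodesicGrowth.geodesicGrowthSeries ω)) :
    (GeodesicGrowth.HasExponentialGeodesicGrowth ω ∨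
      (IsRationalSeries (GeodesicGrowth.geodesicGrowthSeries ω) ∧
        GeodesicGrowth.HasPolynomialGeodesicGrowth ω)) ∧
    ¬ (GeodesicGrowth.HasExponentialGeodesicGrowth ω ∧
        GeodesicGrowth.HasPolynomialGeodesicGrowth ω) := by
  refine ⟨or_iff_not_imp_left.2 fun hexp => ?_, GeodesicGrowth.not_exponential_and_polynomial ω⟩
  have hbound : ∀ x : ℝ, 1 < x → ∃ C : ℝ, ∀ n,
      |(((GeodesicGrowth.geodesicGrowth ω n : ℤ)) : ℝ)| ≤ C * x ^ n := fun x hx => by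
    obtain ⟨C, -, hC⟩ := GeodesicGrowth.exists_geodesicGrowth_le_pow hexp hx
    exact ⟨C, fun n => by simpa using hC n⟩
  have hseries : GeodesicGrowth.geodesicGrowthSeries ω =
      intSeries fun n => (GeodesicGrowth.geodesicGrowth ω n : ℤ) := by
    ext n
    simp [GeodesicGrowth.geodesicGrowthSeries, intSeries]
  have hconv : DiscConvergent (GeodesicGrowth.geodesicGrowthSeries ω) :=
    DiscConvergent.of_norm_coeff_le fun x hx => by
      simpa [GeodesicGrowth.geodesicGrowthSeries] using hbound x hx
  obtain ⟨Z, hZ⟩ := hf.exists_extendsAt hconv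
  rw [hseries] at hZ
  obtain ⟨Q, P, hQ, hQP⟩ := exists_polynomial_mul_intSeries_eq hbound Z hZ
  rw [← hseries] at hQP
  exact ⟨isRationalSeries_of_polynomial_mul_eq hQ hQP,
    GeodesicGrowth.hasPolynomialGeodesicGrowth_of_polynomiallyBounded
      (hconv.polynomiallyBounded hQ hQP)⟩
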